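/- **Setting.** Let $n\ge 0$ be an integer. Let $\mathbb H^2$ be the hyperbolic plane, $L_k=(T\mathbb H^2)^{\otimes_{\mathbb C} k}$ with its induced metric $\langle\,,\rangle$ and Levi-Civita connection $\overline\nabla$, and $E=\mathbb R\oplus L_1\oplus\dots\oplus L_n$. For $X\in T\mathbb H^2$ and $Y\in L_k$ let $i_XY\in L_{k-1}$ be defined by $\langle i_XY,Z\rangle=\langle Y,X\otimes Z\rangle$. With $Y_{n+1}=0$, let $\nabla$ be the connection on $E$ given by $$(\nabla_XY)_0=X\cdot Y_0+\tfrac12(n+1)\langle X,Y_1\rangle,\qquad (\nabla_XY)_k=(n-k+1)X\otimes Y_{k-1}+\overline\nabla_XY_k+\tfrac14(n+k+1)\,i_XY_{k+1}\quad(1\le k\le n),$$ and let $\lfloor Y,Z\rfloor=\sum_{k=0}^n(-1)^{k+1}a_k\langle Y_k,Z_k\rangle$ with $a_0=1$, $a_{k+1}=2^{-(2k+1)}\prod_{j=0}^k\frac{n+j+1}{n-j}$. The connection $\nabla$ is flat, it preserves $\lfloor\,,\rfloor$, and both are preserved by the natural action of $SL(2,\mathbb R)$ on $E$; the action of $SL(2,\mathbb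 R)$ on the $\nabla$-parallel sections of $E$ over $\mathbb H^2$ is isomorphic to the standard irreducible representation $\lambda$ on $\mathbb R^{2n+1}=\mathrm{Sym}^{2n}(\mathbb R^2)$. Fix an $SL(2,\mathbb R)$-equivariant isomorphism $v\mapsto T(v)$ of $\mathbb R^{2n+1}$ onto the parallel sections of $E$, and equip $\mathbb R^{2n+1}$ with the form $\lfloor v,w\rfloor=\lfloor T(v),T(w)\rfloor$. Let $\iota:\Gamma\to SL(2,\mathbb R)$ be a discrete faithful representation such that $\iota(\Gamma)$ acts freely on $\mathbb H^2$ with compact quotient $S=\mathbb H^2/\iota(\Gamma)$, and let $E_S=E/\Gamma$, a flat bundle over $S$ with holonomy $\hat\rho=\lambda\circ\iota$. Let $\rho:\Gamma\to \mathrm{Aff}(\mathbb R^{2n+1})$ be an affine action with linear part $\hat\rho$. Let $\alpha$ be a smooth $d^\nabla$-closed $1$-form on $S$ with values in $E_S$ such that the flat connection $\nabla^\alpha_X(r,U)=(X\cdot r,\ r\,\alpha(X)+\nabla_XU)$ on $F=\mathbb R\oplus E_S$ has holonomy $\rho$, where affine maps of $\mathbb R^{2n+1}$ are seen as linear maps of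 $\mathbb R\oplus\mathbb R^{2n+1}$ preserving $\{1\}\times\mathbb R^{2n+1}$. This means that there is a linear $\Gamma$-equivariant map from $\mathbb R\oplus\mathbb R^{2n+1}$ to the $\nabla^\alpha$-parallel sections of $\mathbb R\oplus E$ over $\mathbb H^2$ which is $(0,v)\mapsto(0,T(v))$ on $\mathbb R^{2n+1}$ and preserves the $\mathbb R$-component. **Invariant vector and Margulis invariant.** Fix an orientation of $\mathbb R^{2n+1}$, and a consistent orientation of the isotropic $n$-planes, given by a linear surjection $\theta:\mathbb R^{2n+1}\to\mathbb R^n$ whose kernel is definite for $\lfloor\,,\rfloor$ (for $n=1$ this is the choice of a component of the light cone minus the origin): an isotropic $n$-plane is oriented so that $\theta$ restricted to it preserves orientation. For $\gamma\in\Gamma$, $\gamma\neq1$, the element $\hat\rho(\gamma)$ has $2n+1$ distinct real eigenvalues, one of them equal to $1$; let $l_1<\dots<l_{2n}$ be the others. The invariant vector $v_{\hat\rho(\gamma)}$ is the fixed vector $v$ of $\hat\rho(\gamma)$ with $|\lfloor v,v\rfloor|=1$ such that $(v,e_1,\dots,e_{2n})$ is a positively oriented basis, where $e_i$ are eigenvectors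 for the $l_i$ such that $(e_1,\dots,e_n)$ and $(e_{n+1},\dots,e_{2n})$ are positively oriented bases of the isotropic planes they span. The Margulis invariant of $\rho(\gamma)$ is $\mu(\rho(\gamma))=\lfloor\rho(\gamma)(x)-x,\ v_{\hat\rho(\gamma)}\rfloor$, where $x\in\mathbb R^{2n+1}$. **Proposition.** Let $\gamma\in\Gamma$, $\gamma\ne1$, and let $c:\mathbb R/\mathbb Z\to S$ be a piecewise $C^1$ closed curve in the free homotopy class given by the conjugacy class of $\gamma$, i.e. with a lift $\tilde c:\mathbb R\to\mathbb H^2$ such that $\tilde c(1)=\iota(\gamma)\tilde c(0)$. Let $v_c$ be the parallel section of $E_S$ along $c$ given by the $\hat\rho(\gamma)$-invariant vector $v_{\hat\rho(\gamma)}$, i.e. $v_c(t)$ is the image of $T(v_{\hat\rho(\gamma)})(\tilde c(t))$. Then the function $t\mapsto\lfloor\alpha(\dot c(t)),v_c(t)\rfloor$ is integrable on $[0,1]$ and, for every choice of $x\in\mathbb R^{2n+1}$ in the definition of $\mu$, $$\mu(\rho(\gamma))=\int_c\lfloor\alpha,v_c\rfloor=\int_0^1\lfloor\alpha(\dot c(t)),v_c(t)\rfloor\,dt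 .$$ -/

import Mathlib

open scoped UpperHalfPlane MatrixGroups ComplexConjugate ContDiff

namespace FuchsianAffine

noncomputable section

/-! ### The bundle `E = ℝ ⊕ L₁ ⊕ ⋯ ⊕ Lₙ` over the hyperbolic plane

The hyperbolic plane is the upper half-plane with the metric `(dx² + dy²)/y²`.  The holomorphic
frame `∂/∂z ↔ 1` identifies `T_z ℍ` with `ℂ`, hence `L_k = (Tℍ)^{⊗ k}` (tensor power over `ℂ`)
with `ℍ × ℂ`; tensor product of vectors becomes multiplication of complex numbers. -/

/-- The fibre `ℝ ⊕ ℂⁿ` of `E`; the entry of index `i : Fin n` is the component on `L_{i+1}`. -/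
abbrev Fibre (n : ℕ) : Type := ℝ × (Fin n → ℂ)

/-- The component `Y_k` of a vector of `E` (on `ℝ` if `k = 0`, on `L_k` if `1 ≤ k ≤ n`, and zero
for `k > n`). -/
def component {n : ℕ} (Y : Fibre n) : ℕ → ℂ
  | 0 => (Y.1 : ℂ)
  | k + 1 => if h : k < n then Y.2 ⟨k, h⟩ else 0

/-- The real metric `⟨u, v⟩` on the fibre of `L_k` at `z` induced by the hyperbolic metric. -/
def lineInner (k : ℕ) (z : ℍ) (u v : ℂ) : ℝ := (u * conj v).re / z.im ^ (2 * k)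

/-- The contraction `i_X Y`, characterised by `⟨i_X Y, Z⟩ = ⟨Y, X ⊗ Z⟩`. -/
def contract (z : ℍ) (X Y : ℂ) : ℂ := conj X * Y / (z.im : ℂ) ^ 2

/-- The contraction is the adjoint of the tensor product with `X`. -/
theorem lineInner_contract (k : ℕ) (z : ℍ) (X Y Z : ℂ) :
    lineInner k z (contract z X Y) Z = lineInner (k + 1) z Y (X * Z) := by
  have hz : z.im ≠ 0 := z.im_ne_zero
  have h : contract z X Y * conj Z = (((z.im ^ 2)⁻¹ : ℝ) : ℂ) * (Y * conj (X * Z)) := by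
    simp only [contract, map_mul]
    push_cast
    field_simp
  rw [lineInner, h, Complex.re_ofReal_mul, lineInner]
  field_simp
  ring

/-- The connection on `L_k` induced by the Levi-Civita connection of the hyperbolic metric, which is
`∇̄_X Y = dY(X) + (i / y) X Y` on `L₁ = Tℍ`. -/
def leviCivita (k : ℕ) (Y : ℍ → ℂ) (z : ℍ) (X : ℂ) : ℂ :=
  fderiv ℝ (fun w : ℂ => Y (UpperHalfPlane.ofComplex w)) z X
    + k * (Complex.I / z.im) * X * Y z

/-- The connection `∇` on `E`. -/
def nabla {n : ℕ} (Y : ℍ → Fibre n) (z : ℍ) (X : ℂ) : Fibre n :=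
  (fderiv ℝ (fun w : ℂ => (Y (UpperHalfPlane.ofComplex w)).1) z X
      + (n + 1) / 2 * lineInner 1 z X (component (Y z) 1),
   fun i =>
    let k : ℕ := i + 1
    ((n : ℂ) - k + 1) * (X * component (Y z) (k - 1))
      + leviCivita k (fun w => component (Y w) k) z X
      + ((n : ℂ) + k + 1) / 4 * contract z X (component (Y z) (k + 1)))

/-- The constants `a₀ = 1`, `a_{k+1} = 2^{-(2k+1)} ∏_{j=0}^{k} (n+j+1)/(n-j)`. -/
def formCoeff (n : ℕ) : ℕ → ℝ
  | 0 => 1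
  | k + 1 => 1 / 2 ^ (2 * k + 1) * ∏ j ∈ Finset.range (k + 1), ((n : ℝ) + j + 1) / ((n : ℝ) - j)

/-- The pseudo-Riemannian metric `⌊Y, Z⌋ = ∑_{k=0}^{n} (-1)^{k+1} a_k ⟨Y_k, Z_k⟩` on `E_z`. -/
def fibreForm {n : ℕ} (z : ℍ) (Y Z : Fibre n) : ℝ :=
  ∑ k ∈ Finset.range (n + 1),
    (-1) ^ (k + 1) * formCoeff n k * lineInner k z (component Y k) (component Z k)

/-- The derivative at `z` of the isometry `w ↦ g • w` of `ℍ`. -/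
def moebiusDeriv (g : SL(2, ℝ)) (z : ℍ) : ℂ := 1 / (UpperHalfPlane.denom g z) ^ 2

/-- The action `E_z → E_{g • z}` of `g ∈ SL(2, ℝ)` on `E`. -/
def push {n : ℕ} (g : SL(2, ℝ)) (z : ℍ) (Y : Fibre n) : Fibre n :=
  (Y.1, fun i => moebiusDeriv g z ^ ((i : ℕ) + 1) * Y.2 i)

/-- Smooth maps from `ℍ` to a real normed space. -/
def IsSmooth {F : Type*} [NormedAddCommGroup F] [NormedSpace ℝ F] (f : ℍ → F) : Prop :=
  ContDiffOn ℝ ∞ (fun w : ℂ => f (UpperHalfPlane.ofComplex w)) {w : ℂ | 0 < w.im}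

/-- Smooth `∇`-parallel sections of `E`. -/
def IsParallel {n : ℕ} (Y : ℍ → Fibre n) : Prop :=
  IsSmooth Y ∧ ∀ (z : ℍ) (X : ℂ), nabla Y z X = 0

/-! ### The standard representation and the flat structure of `E` -/

/-- The space `ℝ^{2n+1}` of the standard irreducible representation of `SL(2, ℝ)`: homogeneous
polynomials of degree `2n` in two variables. -/
abbrev StdSpace (n : ℕ) : Type := MvPolynomial.homogeneousSubmodule (Fin 2) ℝ (2 * n)

/-- The substitution `P(x) ↦ P(g⁻¹ x)`. -/
def substHom (g : SL(2, ℝ)) : MvPolynomial (Fin 2) ℝ →ₐ[ℝ] MvPolynomial (Fin 2) ℝ :=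
  MvPolynomial.aeval fun i =>
    ∑ j, MvPolynomial.C ((g⁻¹ : SL(2, ℝ)) i j) * MvPolynomial.X j

theorem substHom_mem (n : ℕ) (g : SL(2, ℝ)) (P : StdSpace n) :
    substHom g P ∈ MvPolynomial.homogeneousSubmodule (Fin 2) ℝ (2 * n) := by
  have h := MvPolynomial.IsHomogeneous.aeval (n := 1) P.2
    (fun i => ∑ j, MvPolynomial.C ((g⁻¹ : SL(2, ℝ)) i j) * MvPolynomial.X j)
    (fun i => MvPolynomial.IsHomogeneous.sum _ _ _
      fun j _ => MvPolynomial.isHomogeneous_C_mul_X _ j)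
  rwa [one_mul] at h

theorem substHom_one : substHom 1 = AlgHom.id ℝ _ := by
  ext i
  fin_cases i <;> simp [substHom]

theorem substHom_mul (g h : SL(2, ℝ)) : substHom (g * h) = (substHom g).comp (substHom h) := by
  have hX : ∀ (k : SL(2, ℝ)) (i : Fin 2), substHom k (MvPolynomial.X i) =
      MvPolynomial.C ((k⁻¹ : SL(2, ℝ)) i 0) * MvPolynomial.X 0
        + MvPolynomial.C ((k⁻¹ : SL(2, ℝ)) i 1) * MvPolynomial.X 1 := by
    intro k i
    simp [substHom, Fin.sum_univ_two]
  have hC : ∀ (k : SL(2, ℝ)) (r : ℝ), substHom k (MvPolynomial.C r) = MvPolynomial.C r :=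
    fun k r => MvPolynomial.aeval_C _ r
  apply MvPolynomial.algHom_ext
  intro i
  simp only [AlgHom.comp_apply, hX, map_add, map_mul, hC, mul_inv_rev,
    Matrix.SpecialLinearGroup.coe_mul, Matrix.mul_apply, Fin.sum_univ_two]
  ring

/-- The standard representation `λ_{2n+1}` of `SL(2, ℝ)` on `ℝ^{2n+1}`, `(g P)(x) = P(g⁻¹ x)`. -/
def stdRep (n : ℕ) : Representation ℝ SL(2, ℝ) (StdSpace n) where
  toFun g := (substHom g).toLinearMap.restrict fun P hP => substHom_mem n g ⟨P, hP⟩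
  map_one' := by
    ext1 P
    apply Subtype.ext
    simp [substHom_one]
  map_mul' g h := by
    ext1 P
    apply Subtype.ext
    exact congrArg (fun f => f P.1) (substHom_mul g h)

/-- An identification of the flat bundle `(E, ∇)` with the representation `λ_{2n+1}`: a linear
injection of `ℝ^{2n+1}` into the space of parallel sections of `E` which intertwines `λ_{2n+1}` with
the action of `SL(2, ℝ)` on sections of `E`.  (It is unique up to a scalar, and `E_S = E / Γ` is
then a flat bundle with holonomy `λ_{2n+1} ∘ ι`.) -/
structure FlatTrivialization (n : ℕ) where
  toSection : StdSpace n →ₗ[ℝ] (ℍ → Fibre n)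
  injective : Function.Injective toSection
  parallel : ∀ v, IsParallel (toSection v)
  equivariant : ∀ (g : SL(2, ℝ)) (v : StdSpace n) (z : ℍ),
    toSection (stdRep n g v) (g • z) = push g z (toSection v z)

/-- The metric of `ℝ^{2n+1}` given by `⌊ , ⌋` on parallel sections (the value does not depend on the
point of `ℍ` where it is computed). -/
def FlatTrivialization.form {n : ℕ} (T : FlatTrivialization n) (v w : StdSpace n) : ℝ :=
  fibreForm UpperHalfPlane.I (T.toSection v UpperHalfPlane.I) (T.toSection w UpperHalfPlane.I)

/-! ### The invariant vector and the Margulis invariant -/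

/-- A consistent orientation of all isotropic `n`-planes of `ℝ^{2n+1}`, given by a surjection onto
`ℝⁿ` with definite kernel: it is injective on isotropic `n`-planes and orients them by pulling back
the orientation of `ℝⁿ`.  For `n = 1` this is the choice of a component of the light cone, namely
`{u | ⌊u, u⌋ = 0, 0 < u₀}` where `u₀` is the image of `u` in `ℝ`. -/
structure NullOrientation {n : ℕ} (T : FlatTrivialization n) where
  proj : StdSpace n →ₗ[ℝ] (Fin n → ℝ)
  surjective : Function.Surjective proj
  definite_ker : (∀ u, proj u = 0 → u ≠ 0 → 0 < T.form u u) ∨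
    (∀ u, proj u = 0 → u ≠ 0 → T.form u u < 0)

/-- `v` is the invariant vector of the loxodromic element `g`: there are eigenvectors
`e₁, …, e_{2n}` for the eigenvalues `l₁ < ⋯ < l_{2n}` of `g` different from `1` such that
`(e₁, …, e_n)` and `(e_{n+1}, …, e_{2n})` are positive for the orientation of isotropic `n`-planes,
`v` is fixed by `g`, has norm `1`, and `(v, e₁, …, e_{2n})` is a positively oriented basis. -/
def IsInvariantVector {n : ℕ} (T : FlatTrivialization n)
    (o : Orientation ℝ (StdSpace n) (Fin (2 * n + 1))) (θ : NullOrientation T)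
    (g : StdSpace n →ₗ[ℝ] StdSpace n) (v : StdSpace n) : Prop :=
  g v = v ∧ |T.form v v| = 1 ∧
  ∃ (l : Fin (2 * n) → ℝ) (e : Fin (2 * n) → StdSpace n)
    (b : Module.Basis (Fin (2 * n + 1)) ℝ (StdSpace n)),
    StrictMono l ∧ (∀ i, l i ≠ 1) ∧ (∀ i, g (e i) = l i • e i) ∧
    0 < (Matrix.of fun i j : Fin n => θ.proj (e ⟨i, by omega⟩) j).det ∧
    0 < (Matrix.of fun i j : Fin n => θ.proj (e ⟨n + i, by omega⟩) j).det ∧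
    ⇑b = Fin.cons v e ∧ b.orientation = o

open Classical in
/-- The invariant vector `v_g` of a loxodromic element `g`: it exists and is unique as soon as `g`
preserves the metric and has `2n` distinct positive eigenvalues other than `1`, as is the case for
`g = λ_{2n+1}(h)` with `h` hyperbolic.  (Zero if there is no invariant vector.) -/
def invariantVector {n : ℕ} (T : FlatTrivialization n)
    (o : Orientation ℝ (StdSpace n) (Fin (2 * n + 1))) (θ : NullOrientation T)
    (g : StdSpace n →ₗ[ℝ] StdSpace n) : StdSpace n :=
  if h : ∃ v, IsInvariantVector T o θ g v then h.choose else 0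

/-- The Margulis invariant `μ(g) = ⌊g(x) - x, v_ĝ⌋` of an affine isometry `g` with loxodromic linear
part `ĝ`, computed at the point `x`. -/
def margulisInvariant {n : ℕ} (T : FlatTrivialization n)
    (o : Orientation ℝ (StdSpace n) (Fin (2 * n + 1))) (θ : NullOrientation T)
    (g : StdSpace n ≃ᵃ[ℝ] StdSpace n) (x : StdSpace n) : ℝ :=
  T.form (g x - x) (invariantVector T o θ (g.linear : StdSpace n →ₗ[ℝ] StdSpace n))

/-! ### The surface `S = ℍ / Γ`, forms and curves on it -/

/-- The surface `S = ℍ / ι(Γ)`. -/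
abbrev Surface {Γ : Type*} [Group Γ] (ι : Γ →* SL(2, ℝ)) : Type :=
  MulAction.orbitRel.Quotient ι.range ℍ

/-- `ι` is a discrete faithful representation in `SL(2, ℝ)` identifying `Γ` with the fundamental
group of the closed surface `ℍ / ι(Γ)`: the action on `ℍ` is free with compact quotient. -/
structure IsSurfaceGroup {Γ : Type*} [Group Γ] (ι : Γ →* SL(2, ℝ)) : Prop where
  faithful : Function.Injective ι
  discrete : DiscreteTopology ι.range
  free : ∀ (γ : Γ) (z : ℍ), ι γ • z = z → γ = 1
  compact : CompactSpace (Surface ι)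

/-- Smooth `d^∇`-closed `1`-forms on `S` with values in `E_S = E / Γ`, that is, smooth closed
`Γ`-invariant `E`-valued `1`-forms on `ℍ`.  They represent the classes of `H¹(Γ, ℝ^{2n+1})`. -/
structure ClosedForm {Γ : Type*} [Group Γ] (ι : Γ →* SL(2, ℝ)) (n : ℕ) where
  form : ℍ → ℂ →L[ℝ] Fibre n
  smooth : IsSmooth form
  invariant : ∀ (γ : Γ) (z : ℍ) (X : ℂ),
    form (ι γ • z) (moebiusDeriv (ι γ) z * X) = push (ι γ) z (form z X)
  closed : ∀ (z : ℍ) (X Z : ℂ),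
    nabla (fun w => form w Z) z X - nabla (fun w => form w X) z Z = 0

/-- The connection `∇^α` on `F = ℝ ⊕ E`:
`∇^α_X (r, U) = (dr(X), r α(X) + ∇_X U)`. -/
def nablaForm {n : ℕ} (α : ℍ → ℂ →L[ℝ] Fibre n) (s : ℍ → ℝ × Fibre n) (z : ℍ) (X : ℂ) :
    ℝ × Fibre n :=
  (fderiv ℝ (fun w : ℂ => (s (UpperHalfPlane.ofComplex w)).1) z X,
   (s z).1 • α z X + nabla (fun w => (s w).2) z X)

/-- The linear map of `ℝ ⊕ ℝ^{2n+1}` corresponding to an affine map `g` of `ℝ^{2n+1}`, the latter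
space being seen as the affine hyperplane `{1} × ℝ^{2n+1}`. -/
def affineToLinear {V : Type*} [AddCommGroup V] [Module ℝ V] (g : V ≃ᵃ[ℝ] V) (p : ℝ × V) : ℝ × V :=
  (p.1, g.linear p.2 + p.1 • g 0)

/-- The holonomy of the flat connection `∇^α` on `F_S = ℝ ⊕ E_S` is `ρ`: there is an identification
of `ℝ ⊕ ℝ^{2n+1}` with the `∇^α`-parallel sections of `F` over `ℍ` under which `ρ` becomes the
action of `Γ` on these sections, and which extends the given identification of `ℝ^{2n+1}` with
parallel sections of `E ⊆ F` and induces the identity on `F / E = ℝ`. -/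
def HasHolonomy {n : ℕ} (T : FlatTrivialization n) {Γ : Type*} [Group Γ] {ι : Γ →* SL(2, ℝ)}
    (α : ClosedForm ι n) (ρ : Γ →* (StdSpace n ≃ᵃ[ℝ] StdSpace n)) : Prop :=
  ∃ D : (ℝ × StdSpace n) →ₗ[ℝ] (ℍ → ℝ × Fibre n),
    (∀ p, IsSmooth (D p) ∧ ∀ z X, nablaForm α.form (D p) z X = 0) ∧
    (∀ (γ : Γ) (p : ℝ × StdSpace n) (z : ℍ),
      D (affineToLinear (ρ γ) p) (ι γ • z) = ((D p z).1, push (ι γ) z (D p z).2)) ∧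
    (∀ (v : StdSpace n) (z : ℍ), D (0, v) z = (0, T.toSection v z)) ∧
    (∀ (p : ℝ × StdSpace n) (z : ℍ), (D p z).1 = p.1)

/-- `ctilde : ℝ → ℍ` is a lift to the universal cover of the closed curve `c` on `S`. -/
def IsLift {Γ : Type*} [Group Γ] {ι : Γ →* SL(2, ℝ)} (c : C(AddCircle (1 : ℝ), Surface ι))
    (ctilde : ℝ → ℍ) : Prop :=
  Continuous ctilde ∧ ∀ t : ℝ, (Quotient.mk _ (ctilde t) : Surface ι) = c (t : AddCircle (1 : ℝ))

/-- Piecewise `C¹` curves in `ℍ` over `[0, 1]`. -/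
def IsPiecewiseC1 (ctilde : ℝ → ℍ) : Prop :=
  ∃ (N : ℕ) (p : ℕ → ℝ), Monotone p ∧ p 0 = 0 ∧ p N = 1 ∧
    ∀ i < N, ContDiffOn ℝ 1 (fun t => (ctilde t : ℂ)) (Set.Icc (p i) (p (i + 1)))

/-- The function `⌊α(ċ(t)), v_c(t)⌋`, where `v_c` is the parallel section of `E` along `c` given by
the vector `v`; it is computed on a lift of `c`. -/
def integrand {n : ℕ} (T : FlatTrivialization n) {Γ : Type*} [Group Γ] {ι : Γ →* SL(2, ℝ)}
    (α : ClosedForm ι n) (ctilde : ℝ → ℍ) (v : StdSpace n) (t : ℝ) : ℝ :=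
  fibreForm (ctilde t) (α.form (ctilde t) (deriv (fun s => (ctilde s : ℂ)) t))
    (T.toSection v (ctilde t))

/-! ### Existence of the identification of `(E, ∇)` with the standard representation -/

/-- The power `(a x + b y)^{2n}` of a linear form. -/
def linPow (n : ℕ) (a b : ℝ) : StdSpace n :=
  ⟨(MvPolynomial.C a * MvPolynomial.X 0 + MvPolynomial.C b * MvPolynomial.X 1) ^ (2 * n), by
    have h := ((MvPolynomial.isHomogeneous_C_mul_X (σ := Fin 2) a 0).add
      (MvPolynomial.isHomogeneous_C_mul_X (σ := Fin 2) b 1)).pow (2 * n)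
    rwa [one_mul] at h⟩

theorem span_linPow (n : ℕ) : Submodule.span ℝ (Set.range fun a : ℝ => linPow n a 1) = ⊤ := by
  by_contra hne
  obtain ⟨φ, hφ, hker⟩ := Submodule.exists_le_ker_of_lt_top _ (lt_top_iff_ne_top.2 hne)
  apply hφ
  have hmon : ∀ m ∈ Finset.range (2 * n + 1),
      (MvPolynomial.X 0 ^ m * MvPolynomial.X 1 ^ (2 * n - m) : MvPolynomial (Fin 2) ℝ) ∈
        MvPolynomial.homogeneousSubmodule (Fin 2) ℝ (2 * n) := by
    intro m hm
    have h := (MvPolynomial.isHomogeneous_X_pow (R := ℝ) (0 : Fin 2) m).mul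
      (MvPolynomial.isHomogeneous_X_pow (R := ℝ) (1 : Fin 2) (2 * n - m))
    have h2 : m + (2 * n - m) = 2 * n := by
      have := Finset.mem_range.1 hm
      omega
    rwa [h2] at h
  let M : ℕ → StdSpace n := fun m =>
    if hm : m ∈ Finset.range (2 * n + 1) then ⟨_, hmon m hm⟩ else 0
  have hpow : ∀ a : ℝ, linPow n a 1 =
      ∑ m ∈ Finset.range (2 * n + 1), (a ^ m * ((2 * n).choose m : ℝ)) • M m := by
    intro a
    apply Subtype.ext
    rw [linPow, AddSubmonoidClass.coe_finsetSum]
    simp only [map_one, one_mul]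
    rw [add_pow]
    apply Finset.sum_congr rfl
    intro m hm
    simp only [M, dif_pos hm, Submodule.coe_smul, MvPolynomial.smul_eq_C_mul, map_mul, map_pow,
      mul_pow, map_natCast]
    ring
  have hq : (∑ m ∈ Finset.range (2 * n + 1),
      Polynomial.C (((2 * n).choose m : ℝ) * φ (M m)) * Polynomial.X ^ m : Polynomial ℝ) = 0 := by
    apply Polynomial.funext
    intro a
    have h1 : φ (linPow n a 1) = 0 := hker (Submodule.subset_span ⟨a, rfl⟩)
    rw [hpow, map_sum] at h1
    rw [Polynomial.eval_finsetSum, Polynomial.eval_zero, ← h1]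
    apply Finset.sum_congr rfl
    intro m _
    simp only [map_smul, smul_eq_mul, Polynomial.eval_mul, Polynomial.eval_C, Polynomial.eval_pow,
      Polynomial.eval_X]
    ring
  have hM : ∀ m ∈ Finset.range (2 * n + 1), φ (M m) = 0 := by
    intro m hm
    have h1 := congrArg (fun p => Polynomial.coeff p m) hq
    simp only [Polynomial.finsetSum_coeff, Polynomial.coeff_C_mul, Polynomial.coeff_X_pow,
      Polynomial.coeff_zero, mul_ite, mul_one, mul_zero] at h1
    rw [Finset.sum_ite_eq, if_pos hm] at h1
    rcases mul_eq_zero.1 h1 with h2 | h2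
    · have := Nat.choose_pos (n := 2 * n) (k := m) (by have := Finset.mem_range.1 hm; omega)
      norm_cast at h2
      omega
    · exact h2
  ext P
  have hP : P = ∑ d ∈ P.1.support, (MvPolynomial.coeff d P.1) • M (d 0) := by
    apply Subtype.ext
    rw [AddSubmonoidClass.coe_finsetSum]
    conv_lhs => rw [MvPolynomial.as_sum P.1]
    apply Finset.sum_congr rfl
    intro d hd
    have hdeg : d 0 + d 1 = 2 * n := by
      have h1 := MvPolynomial.IsHomogeneous.degree_eq_sum_deg_support P.2 hd
      rw [h1, ← Fin.sum_univ_two (fun i => d i)]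
      exact (Finset.sum_subset (Finset.subset_univ _) (by simp)).symm
    have hd0 : d 0 ∈ Finset.range (2 * n + 1) := Finset.mem_range.2 (by omega)
    have hd1 : 2 * n - d 0 = d 1 := by omega
    simp only [M, dif_pos hd0, Submodule.coe_smul, MvPolynomial.smul_eq_C_mul]
    rw [MvPolynomial.monomial_eq, Finsupp.prod_fintype _ _ (by simp), Fin.prod_univ_two, hd1]
  rw [hP, map_sum, LinearMap.zero_apply]
  apply Finset.sum_eq_zero
  intro d hd
  by_cases hd0 : d 0 ∈ Finset.range (2 * n + 1)
  · rw [map_smul, hM _ hd0, smul_zero]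
  · simp only [M, dif_neg hd0, smul_zero, map_zero]

/-- The polynomial `P(z t + z̄, t + 1)` in `t`. -/
def expand (z : ℍ) : MvPolynomial (Fin 2) ℝ →ₐ[ℝ] Polynomial ℂ :=
  MvPolynomial.aeval ![Polynomial.C (z : ℂ) * Polynomial.X + Polynomial.C (conj (z : ℂ)),
    Polynomial.X + 1]

theorem expand_linPow (n : ℕ) (a b : ℝ) (z : ℍ) (m : ℕ) :
    (expand z (linPow n a b).1).coeff m =
      ((2 * n).choose m : ℂ) * (a * z + b) ^ m * conj (a * z + b : ℂ) ^ (2 * n - m) := by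
  have h : expand z (linPow n a b).1 =
      (Polynomial.C (conj (a * z + b : ℂ)) + Polynomial.C (a * z + b : ℂ) * Polynomial.X)
        ^ (2 * n) := by
    simp only [expand, linPow, map_pow, map_add, map_mul, MvPolynomial.aeval_X,
      MvPolynomial.aeval_C, Matrix.cons_val_zero, Matrix.cons_val_one,
      IsScalarTower.algebraMap_apply ℝ ℂ (Polynomial ℂ), Polynomial.algebraMap_eq,
      Complex.coe_algebraMap, Complex.conj_ofReal]
    congr 1
    ring
  rw [h, add_comm, add_pow]
  simp only [mul_pow, ← Polynomial.C_pow, Polynomial.finsetSum_coeff]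
  have h2 : ∀ x ∈ Finset.range (2 * n + 1),
      (Polynomial.C ((a * z + b : ℂ) ^ x) * Polynomial.X ^ x
        * Polynomial.C (conj (a * z + b : ℂ) ^ (2 * n - x))
        * ((2 * n).choose x : Polynomial ℂ)).coeff m
      = if x = m then ((2 * n).choose m : ℂ) * (a * z + b) ^ m
          * conj (a * z + b : ℂ) ^ (2 * n - m) else 0 := by
    intro x _
    have h3 : (Polynomial.C ((a * z + b : ℂ) ^ x) * Polynomial.X ^ x
        * Polynomial.C (conj (a * z + b : ℂ) ^ (2 * n - x))
        * ((2 * n).choose x : Polynomial ℂ))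
        = Polynomial.C ((a * z + b : ℂ) ^ x * conj (a * z + b : ℂ) ^ (2 * n - x)
            * ((2 * n).choose x : ℂ)) * Polynomial.X ^ x := by
      rw [Polynomial.C_mul, Polynomial.C_mul, map_natCast]
      ring
    rw [h3, Polynomial.coeff_C_mul_X_pow]
    by_cases hx : m = x
    · subst hx
      rw [if_pos rfl, if_pos rfl]
      ring
    · rw [if_neg hx, if_neg (Ne.symm hx)]
  rw [Finset.sum_congr rfl h2, Finset.sum_ite_eq']
  split_ifs with h4
  · rfl
  · rw [Nat.choose_eq_zero_of_lt (by have := Finset.mem_range.not.1 h4; omega)]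
    simp

/-- The section of `E` defined by a polynomial. -/
def polySection (n : ℕ) : StdSpace n →ₗ[ℝ] (ℍ → Fibre n) where
  toFun P z := (((expand z P.1).coeff n).re / z.im ^ n,
    fun i => (2 * Complex.I) ^ ((i : ℕ) + 1) * (z.im : ℂ) ^ ((i : ℕ) + 1) / (z.im : ℂ) ^ n
      * (expand z P.1).coeff (n + i + 1))
  map_add' P Q := by
    funext z
    refine Prod.ext ?_ (funext fun i => ?_)
    · simp [add_div]
    · simp [mul_add]
  map_smul' r P := by
    funext z
    refine Prod.ext ?_ (funext fun i => ?_)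
    · simp [mul_div_assoc]
    · simp
      ring

theorem component_polySection (n : ℕ) (a b : ℝ) (z : ℍ) (k : ℕ) :
    component (polySection n (linPow n a b) z) k =
      (2 * Complex.I) ^ k * ((2 * n).choose (n + k) : ℂ) * (a * z + b) ^ (n + k)
        * (conj (a * z + b : ℂ) / z.im) ^ (n - k) := by
  have hz : (z.im : ℂ) ≠ 0 := by exact_mod_cast z.im_ne_zero
  rcases k with _ | k
  · have h : (expand z (linPow n a b).1).coeff n =
        (((2 * n).choose n * Complex.normSq (a * z + b) ^ n : ℝ) : ℂ) := by
      rw [expand_linPow, show 2 * n - n = n by omega, mul_assoc, ← mul_pow, Complex.mul_conj]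
      push_cast
      rfl
    simp only [component, polySection, LinearMap.coe_mk, AddHom.coe_mk]
    rw [h, Complex.ofReal_re, Complex.ofReal_div, ← h, expand_linPow]
    rw [show 2 * n - n = n by omega]
    simp only [pow_zero, add_zero, Nat.sub_zero, div_pow]
    push_cast
    ring
  · by_cases hk : k < n
    · simp only [component, polySection, LinearMap.coe_mk, AddHom.coe_mk, dif_pos hk]
      rw [expand_linPow, show 2 * n - (n + k + 1) = n - (k + 1) by omega, div_pow,
        show n + k + 1 = n + (k + 1) by ring]
      have h2 : (z.im : ℂ) ^ n = (z.im : ℂ) ^ (k + 1) * (z.im : ℂ) ^ (n - (k + 1)) := by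
        rw [← pow_add]
        congr 1
        omega
      rw [h2]
      field_simp
    · simp only [component, dif_neg hk]
      rw [Nat.choose_eq_zero_of_lt (by omega)]
      simp

theorem ext_component {n : ℕ} {Y Z : Fibre n} (h : ∀ k ≤ n, component Y k = component Z k) :
    Y = Z := by
  refine Prod.ext ?_ (funext fun i => ?_)
  · exact Complex.ofReal_injective (h 0 (Nat.zero_le n))
  · have := h (i + 1) i.2
    simpa [component] using this

theorem component_push {n : ℕ} (g : SL(2, ℝ)) (z : ℍ) (Y : Fibre n) (k : ℕ) :
    component (push g z Y) k = moebiusDeriv g z ^ k * component Y k := by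
  rcases k with _ | k
  · simp [component, push]
  · by_cases hk : k < n <;> simp [component, push, hk]

/-- The component on `L_k` as a linear map. -/
def componentLin (n k : ℕ) : Fibre n →ₗ[ℝ] ℂ where
  toFun Y := component Y k
  map_add' Y Z := by
    rcases k with _ | k
    · simp [component]
    · by_cases hk : k < n <;> simp [component, hk]
  map_smul' r Y := by
    rcases k with _ | k
    · simp [component]
    · by_cases hk : k < n <;> simp [component, hk]

theorem component_add {n : ℕ} (Y Z : Fibre n) (k : ℕ) :
    component (Y + Z) k = component Y k + component Z k := (componentLin n k).map_add Y Z

theorem component_smul {n : ℕ} (r : ℝ) (Y : Fibre n) (k : ℕ) :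
    component (r • Y) k = r • component Y k := (componentLin n k).map_smul r Y

theorem polySection_span {n : ℕ} {p : StdSpace n → Prop} (h0 : p 0)
    (hadd : ∀ v w, p v → p w → p (v + w)) (hsmul : ∀ (r : ℝ) v, p v → p (r • v))
    (hpow : ∀ a : ℝ, p (linPow n a 1)) (v : StdSpace n) : p v := by
  have hv : v ∈ Submodule.span ℝ (Set.range fun a : ℝ => linPow n a 1) := by
    rw [span_linPow]
    trivial
  induction hv using Submodule.span_induction with
  | mem x hx =>
    obtain ⟨a, rfl⟩ := hx
    exact hpow a
  | zero => exact h0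
  | add x y _ _ hx hy => exact hadd x y hx hy
  | smul r x _ hx => exact hsmul r x hx

theorem stdRep_linPow (n : ℕ) (g : SL(2, ℝ)) (a b : ℝ) :
    stdRep n g (linPow n a b) = linPow n (a * g 1 1 - b * g 1 0) (b * g 0 0 - a * g 0 1) := by
  apply Subtype.ext
  change substHom g _ = _
  simp only [linPow, substHom, Fin.sum_univ_two, Matrix.SpecialLinearGroup.coe_inv,
    Matrix.adjugate_fin_two]
  simp
  ring

theorem polySection_equivariant (n : ℕ) (g : SL(2, ℝ)) (v : StdSpace n) (z : ℍ) :
    polySection n (stdRep n g v) (g • z) = push g z (polySection n v z) := by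
  apply ext_component
  intro k hk
  rw [component_push]
  revert v
  apply polySection_span
  · simp only [map_zero, Pi.zero_apply]
    have : component (0 : Fibre n) k = 0 := (componentLin n k).map_zero
    rw [this, mul_zero]
  · intro v w hv hw
    simp only [map_add, Pi.add_apply, component_add, hv, hw, mul_add]
  · intro r v hv
    simp only [map_smul, Pi.smul_apply, component_smul, hv, mul_smul_comm]
  · intro a
    rw [stdRep_linPow, component_polySection, component_polySection]
    have hj : UpperHalfPlane.denom g z ≠ 0 := UpperHalfPlane.denom_ne_zero g z
    have hj2 : UpperHalfPlane.denom g z = g 1 0 * z + g 1 1 := rfl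
    have hdet : ((g 0 0 : ℝ) : ℂ) * g 1 1 - g 0 1 * g 1 0 = 1 := by
      have := g.2
      rw [Matrix.det_fin_two] at this
      exact_mod_cast this
    have hcoe : ((g • z : ℍ) : ℂ) = (g 0 0 * z + g 0 1) / UpperHalfPlane.denom g z := by
      rw [UpperHalfPlane.coe_specialLinearGroup_apply]
      rfl
    have hL : (((a * g 1 1 - 1 * g 1 0 : ℝ) : ℂ) * ((g • z : ℍ) : ℂ)
        + ((1 * g 0 0 - a * g 0 1 : ℝ) : ℂ)) = (a * z + (1 : ℝ)) / UpperHalfPlane.denom g z := by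
      rw [hcoe]
      field_simp
      rw [hj2]
      push_cast
      linear_combination (a * (z : ℂ) + 1) * hdet
    have him : (((g • z : ℍ).im : ℝ) : ℂ)
        = z.im / (UpperHalfPlane.denom g z * conj (UpperHalfPlane.denom g z)) := by
      have h1 : (g • z : ℍ).im = z.im / Complex.normSq (UpperHalfPlane.denom g z) := by
        have := UpperHalfPlane.im_smul_eq_div_normSq (g : GL (Fin 2) ℝ) z
        have h2 : (g • z : ℍ) = (g : GL (Fin 2) ℝ) • z := rfl
        rw [h2]
        simpa using this
      rw [h1, Complex.mul_conj]
      push_cast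
      rfl
    have hcj : conj (UpperHalfPlane.denom g z) ≠ 0 := by simp [hj]
    have hz : (z.im : ℂ) ≠ 0 := by exact_mod_cast z.im_ne_zero
    have hM : conj ((a * z + (1 : ℝ) : ℂ) / UpperHalfPlane.denom g z) / ((g • z : ℍ).im : ℂ)
        = conj (a * z + (1 : ℝ) : ℂ) / z.im * UpperHalfPlane.denom g z := by
      rw [him, map_div₀]
      field_simp
    rw [hL, hM, moebiusDeriv]
    have hpow : UpperHalfPlane.denom g z ^ (n + k)
        = (UpperHalfPlane.denom g z ^ 2) ^ k * UpperHalfPlane.denom g z ^ (n - k) := by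
      rw [← pow_mul, ← pow_add]
      congr 1
      omega
    rw [div_pow, mul_pow, hpow, div_pow, one_pow]
    generalize conj ((a : ℂ) * z + (1 : ℝ)) / (z.im : ℂ) = M
    field_simp
    ring

theorem polySection_injective (n : ℕ) : Function.Injective (polySection n) := by
  rw [injective_iff_map_eq_zero]
  intro P hP
  have h1 : ∀ (z : ℍ) (P : StdSpace n), component (polySection n P z) n =
      (2 * Complex.I) ^ n * MvPolynomial.aeval ![(z : ℂ), 1] P.1 := by
    intro z
    apply polySection_span
    · simp only [map_zero, Pi.zero_apply]
      have : component (0 : Fibre n) n = 0 := (componentLin n n).map_zero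
      rw [this]
      simp
    · intro v w hv hw
      simp only [map_add, Pi.add_apply, component_add, hv, hw, Submodule.coe_add, mul_add]
    · intro r v hv
      simp only [map_smul, Pi.smul_apply, component_smul, hv, Submodule.coe_smul, mul_smul_comm]
    · intro a
      rw [component_polySection, ← two_mul]
      simp [linPow]
  have h2 : ∀ z : ℍ, MvPolynomial.aeval ![(z : ℂ), 1] P.1 = 0 := by
    intro z
    have h3 := h1 z P
    rw [hP, Pi.zero_apply] at h3
    have h4 : component (0 : Fibre n) n = 0 := (componentLin n n).map_zero
    rw [h4] at h3
    have h5 : (2 * Complex.I) ^ n ≠ 0 := by simp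
    exact (mul_eq_zero.1 h3.symm).resolve_left h5
  let q : Polynomial ℝ := MvPolynomial.aeval ![(Polynomial.X : Polynomial ℝ), 1] P.1
  have hcomp : ∀ {A : Type} [CommRing A] [Algebra ℝ A] (x : A),
      Polynomial.aeval x q = MvPolynomial.aeval ![x, 1] P.1 := by
    intro A _ _ x
    have h6 : ((Polynomial.aeval x).comp
        (MvPolynomial.aeval ![(Polynomial.X : Polynomial ℝ), 1])) =
        (MvPolynomial.aeval ![x, 1] : MvPolynomial (Fin 2) ℝ →ₐ[ℝ] A) := by
      apply MvPolynomial.algHom_ext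
      intro i
      fin_cases i <;> simp
    exact congrArg (fun f => f P.1) h6
  have hq : q = 0 := by
    have h7 : q.map (algebraMap ℝ ℂ) = 0 := by
      apply Polynomial.eq_zero_of_infinite_isRoot
      apply Set.infinite_of_injective_forall_mem (f := fun m : ℕ => ((m : ℂ) + Complex.I))
      · intro m m' h
        simpa using h
      · intro m
        have h8 := h2 ⟨(m : ℂ) + Complex.I, by simp⟩
        rw [← hcomp] at h8
        rw [Set.mem_ofPred_eq, Polynomial.IsRoot.def, Polynomial.eval_map_algebraMap]
        exact h8
    exact (Polynomial.map_eq_zero_iff (algebraMap ℝ ℂ).injective).1 h7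
  have hscale : ∀ (x y : ℝ) (P : StdSpace n),
      MvPolynomial.eval ![y * x, y] P.1 = y ^ (2 * n) * MvPolynomial.aeval ![x, 1] P.1 := by
    intro x y
    apply polySection_span
    · simp
    · intro v w hv hw
      simp only [Submodule.coe_add, map_add, hv, hw, mul_add]
    · intro r v hv
      simp only [Submodule.coe_smul, MvPolynomial.smul_eval, hv, map_smul, smul_eq_mul]
      ring
    · intro a
      simp [linPow]
      rw [← mul_pow]
      ring
  apply Subtype.ext
  apply MvPolynomial.funext_set (fun _ => {x : ℝ | x ≠ 0}) (fun _ => ?_)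
  · intro x hx
    have hx1 : x 1 ≠ 0 := hx 1 (Set.mem_univ _)
    have h9 : x = ![x 1 * (x 0 / x 1), x 1] := by
      ext i
      fin_cases i
      · simp only [Fin.zero_eta, Matrix.cons_val_zero]
        field_simp
      · rfl
    rw [h9, hscale, ← hcomp, hq]
    simp
  · exact (Set.finite_singleton (0 : ℝ)).infinite_compl

theorem isSmooth_component {n : ℕ} {Y : ℍ → Fibre n} (h : IsSmooth Y) (z : ℍ) (k : ℕ) :
    DifferentiableAt ℝ (fun w : ℂ => component (Y (UpperHalfPlane.ofComplex w)) k) z := by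
  have h1 : DifferentiableAt ℝ (fun w : ℂ => Y (UpperHalfPlane.ofComplex w)) z :=
    (h.contDiffAt ((isOpen_lt continuous_const Complex.continuous_im).mem_nhds
      z.coe_im_pos)).differentiableAt (by simp)
  exact ((LinearMap.toContinuousLinearMap (componentLin n k)).differentiableAt).comp _ h1

theorem nabla_component {n : ℕ} {Y : ℍ → Fibre n} (h : IsSmooth Y) (z : ℍ) (X : ℂ) (k : ℕ) :
    component (nabla Y z X) k = 
    if k = 0 then
      leviCivita 0 (fun w => component (Y w) 0) z X
        + ((n + 1) / 2 * lineInner 1 z X (component (Y z) 1) : ℝ)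
    else if k ≤ n then ((n : ℂ) - k + 1) * (X * component (Y z) (k - 1))
      + leviCivita k (fun w => component (Y w) k) z X
      + ((n : ℂ) + k + 1) / 4 * contract z X (component (Y z) (k + 1)) else 0 := by
  rcases k with _ | k
  · have h1 : DifferentiableAt ℝ (fun w : ℂ => (Y (UpperHalfPlane.ofComplex w)).1) z := by
      have h2 : DifferentiableAt ℝ (fun w : ℂ => Y (UpperHalfPlane.ofComplex w)) z :=
        (h.contDiffAt ((isOpen_lt continuous_const Complex.continuous_im).mem_nhds
          z.coe_im_pos)).differentiableAt (by simp)
      exact h2.fst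
    have h3 : fderiv ℝ (fun w : ℂ => component (Y (UpperHalfPlane.ofComplex w)) 0) z X
        = ((fderiv ℝ (fun w : ℂ => (Y (UpperHalfPlane.ofComplex w)).1) z X : ℝ) : ℂ) := by
      have h4 := (Complex.ofRealCLM.hasFDerivAt.comp (z : ℂ) h1.hasFDerivAt).fderiv
      have h5 : (fun w : ℂ => component (Y (UpperHalfPlane.ofComplex w)) 0)
          = Complex.ofRealCLM ∘ (fun w : ℂ => (Y (UpperHalfPlane.ofComplex w)).1) := rfl
      rw [h5, h4]
      rfl
    simp only [if_true, leviCivita, h3]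
    simp [component, nabla]
  · by_cases hk : k < n
    · have hk' : k + 1 ≤ n := hk
      simp [component, nabla, hk, hk']
    · have hk' : ¬ (k + 1 ≤ n) := hk
      simp [component, hk, hk']


theorem fderiv_linPow (n k : ℕ) (a : ℝ) (z : ℍ) (X : ℂ) (c : ℂ) :
    fderiv ℝ (fun w : ℂ => c * (a * w + (1 : ℝ)) ^ (n + k)
        * (conj (a * w + (1 : ℝ) : ℂ) / w.im) ^ (n - k)) z X =
      c * ((n + k : ℕ) * (a * z + (1 : ℝ)) ^ (n + k - 1) * (a * X))
          * (conj (a * z + (1 : ℝ) : ℂ) / z.im) ^ (n - k)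
      + c * (a * z + (1 : ℝ)) ^ (n + k)
        * ((n - k : ℕ) * (conj (a * z + (1 : ℝ) : ℂ) / z.im) ^ (n - k - 1)
          * ((a * conj X * z.im - conj (a * z + (1 : ℝ) : ℂ) * X.im) / (z.im : ℂ) ^ 2)) := by
  have hz : (z.im : ℂ) ≠ 0 := by exact_mod_cast z.im_ne_zero
  have h1 : HasFDerivAt (fun w : ℂ => (a * w + (1 : ℝ) : ℂ))
      ((a : ℂ) • ContinuousLinearMap.id ℝ ℂ) (z : ℂ) :=
    ((hasFDerivAt_id (z : ℂ)).const_smul (a : ℂ)).add_const _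
  have h2 : HasFDerivAt (fun w : ℂ => conj (a * w + (1 : ℝ) : ℂ))
      ((Complex.conjCLE : ℂ →L[ℝ] ℂ).comp ((a : ℂ) • ContinuousLinearMap.id ℝ ℂ)) (z : ℂ) :=
    (Complex.conjCLE : ℂ →L[ℝ] ℂ).hasFDerivAt.comp (z : ℂ) h1
  have h3 : HasFDerivAt (fun w : ℂ => (w.im : ℂ))
      (Complex.ofRealCLM.comp Complex.imCLM) (z : ℂ) :=
    (Complex.ofRealCLM.comp Complex.imCLM).hasFDerivAt
  have hline : HasDerivAt (fun t : ℝ => (z : ℂ) + t * X) X 0 := by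
    have := ((Complex.ofRealCLM.hasDerivAt (x := (0 : ℝ))).mul_const X).const_add (z : ℂ)
    simpa using this
  have hz0 : (z : ℂ) + ((0 : ℝ) : ℂ) * X = z := by simp
  have e1 : HasDerivAt (fun t : ℝ => (a * ((z : ℂ) + t * X) + (1 : ℝ) : ℂ)) (a * X) 0 := by
    have := HasFDerivAt.comp_hasDerivAt (0 : ℝ) (by rw [hz0]; exact h1) hline
    simpa [Function.comp_def] using this
  have e2 : HasDerivAt (fun t : ℝ => conj (a * ((z : ℂ) + t * X) + (1 : ℝ) : ℂ)) (a * conj X) 0 := by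
    have := HasFDerivAt.comp_hasDerivAt (0 : ℝ) (by rw [hz0]; exact h2) hline
    simpa [Function.comp_def] using this
  have e3 : HasDerivAt (fun t : ℝ => (((z : ℂ) + t * X).im : ℂ)) X.im 0 := by
    have := HasFDerivAt.comp_hasDerivAt (0 : ℝ) (by rw [hz0]; exact h3) hline
    simpa [Function.comp_def] using this
  have e4 := ((e1.pow (n + k)).const_mul c).mul ((e2.div e3 (by rw [hz0]; exact hz)).pow (n - k))
  have hd : DifferentiableAt ℝ (fun w : ℂ => c * (a * w + (1 : ℝ)) ^ (n + k)
        * (conj (a * w + (1 : ℝ) : ℂ) / w.im) ^ (n - k)) ((z : ℂ) + ((0 : ℝ) : ℂ) * X) := by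
    rw [hz0]
    have h4 : DifferentiableAt ℝ (fun w : ℂ => conj (a * w + (1 : ℝ) : ℂ) / (w.im : ℂ)) z :=
      by
      simpa only [div_eq_mul_inv] using h2.differentiableAt.fun_mul (h3.differentiableAt.fun_inv hz)
    exact ((h1.differentiableAt.fun_pow _).const_mul c).fun_mul (h4.fun_pow _)
  have e5 := hd.hasFDerivAt.comp_hasDerivAt (0 : ℝ) hline
  have e6 := e5.unique e4
  rw [hz0] at e6
  rw [e6]
  simp only [Pi.pow_apply, Pi.div_apply, hz0]
  rfl

theorem nabla_algebra (i D C0 C1 C2 m p κ X Xc P M N L q : ℂ) (hi : i ^ 2 = -1)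
    (h1 : C1 * p = C0 * (m + 1)) (h2 : C2 * (p + 1) = C1 * m) (hp : p = m + 2 * κ) :
    (m + 1) * (X * (D * C0 * P * (M * (M * N))))
      + (D * (2 * i) * C1 * (p * P * (-(i / 2) * (L * q - M) * X)) * (M * N)
        + D * (2 * i) * C1 * (L * P) * (m * N * (-(i / 2) * (L * Xc * q - M * X) * q))
        + κ * (i * q) * X * (D * (2 * i) * C1 * (L * P) * (M * N)))
      + (p + 1) / 4 * (Xc * (D * (2 * i) * (2 * i) * C2 * (L * L * P) * N) * q ^ 2) = 0 := by
  have hp' : κ = (p - m) / 2 := by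
    rw [hp]
    ring
  subst hp'
  linear_combination (-(X * D * P * M ^ 2 * N)) * h1
    + (i ^ 2 * Xc * D * L ^ 2 * P * N * q ^ 2) * h2
    + (-(D * C1 * p * P * X * M * N * (L * q - M))
        - D * C1 * L * P * m * N * (L * Xc * q - M * X) * q
        + (p - m) * D * C1 * X * L * P * M * N * q
        + Xc * D * L ^ 2 * P * N * q ^ 2 * (C1 * m)) * hi

theorem nabla_algebra_top (i D C0 C1 p κ X P M L q : ℂ) (hi : i ^ 2 = -1)
    (h1 : C1 * p = C0) (hp : p = 2 * κ) :
    X * (D * C0 * P * M) + (D * (2 * i) * C1 * (p * P * (-(i / 2) * (L * q - M) * X))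
        + κ * (i * q) * X * (D * (2 * i) * C1 * (L * P))) = 0 := by
  have hp' : κ = p / 2 := by
    rw [hp]
    ring
  subst hp'
  linear_combination (-(X * D * P * M)) * h1 + (D * C1 * p * P * X * M) * hi

theorem nabla_algebra_zero (i C0 C1 N X Xc P Q M L q : ℂ)
    (h1 : C1 * (N + 1) = C0 * N) :
    C0 * (N * P * (-(i / 2) * (L * q - M) * X)) * (M * Q)
      + C0 * (L * P) * (N * Q * (-(i / 2) * (L * Xc * q - M * X) * q))
      + (N + 1) / 2 * ((X * (-(2 * i) * C1 * M ^ 2 * Q * P)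
        + Xc * (2 * i * C1 * L ^ 2 * P * Q * q ^ 2)) / 2) = 0 := by
  linear_combination (i / 2 * (Xc * L ^ 2 * P * Q * q ^ 2 - X * M ^ 2 * Q * P)) * h1

theorem nabla_linPow (n : ℕ) (a : ℝ) (hs : IsSmooth (polySection n (linPow n a 1)))
    (z : ℍ) (X : ℂ) : nabla (polySection n (linPow n a 1)) z X = 0 := by
  apply ext_component
  intro k hk
  have hzero : component (0 : Fibre n) k = 0 := (componentLin n k).map_zero
  rw [hzero, nabla_component hs]
  have hz : (z.im : ℂ) ≠ 0 := by exact_mod_cast z.im_ne_zero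
  have hfd : fderiv ℝ (fun w : ℂ => component (polySection n (linPow n a 1)
      (UpperHalfPlane.ofComplex w)) k) z X =
      fderiv ℝ (fun w : ℂ => ((2 * Complex.I) ^ k * ((2 * n).choose (n + k) : ℂ))
        * (a * w + (1 : ℝ)) ^ (n + k) * (conj (a * w + (1 : ℝ) : ℂ) / w.im) ^ (n - k)) z X := by
    congr 1
    apply Filter.EventuallyEq.fderiv_eq
    filter_upwards [(isOpen_lt continuous_const Complex.continuous_im).mem_nhds z.coe_im_pos]
      with w hw
    rw [UpperHalfPlane.ofComplex_apply_of_im_pos hw, component_polySection]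
    rfl
  have hX : (X.im : ℂ) = (X - conj X) / (2 * Complex.I) := by
    rw [Complex.sub_conj]
    push_cast
    field_simp
  have hy : (z.im : ℂ) = ((z : ℂ) - conj (z : ℂ)) / (2 * Complex.I) := by
    rw [Complex.sub_conj, UpperHalfPlane.coe_im]
    push_cast
    field_simp
  set L : ℂ := a * z + (1 : ℝ) with hL
  set y : ℂ := (z.im : ℂ) with hydef
  set M : ℂ := conj L / y with hM
  have hLc : conj L = y * M := by
    rw [hM]
    field_simp
  have haL : (a : ℂ) * (2 * Complex.I * y) = L - y * M := by
    rw [← hLc, hL, hy]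
    simp
    field_simp
  have hMc : conj M = L / y := by
    rw [hM, map_div₀, Complex.conj_conj, hydef, Complex.conj_ofReal]
  have ha : (a : ℂ) = (L - y * M) / (2 * Complex.I * y) := by
    rw [← haL]
    field_simp
  have hI : Complex.I ^ 2 = -1 := Complex.I_sq
  clear_value L y M
  have hMp : ((a : ℂ) * conj X * y - conj L * X.im) / y ^ 2
      = -(Complex.I / 2) * (L * conj X * y⁻¹ - M * X) * y⁻¹ := by
    rw [ha, hLc, hX]
    field_simp
    linear_combination (L * conj X - y * M * X) * hI
  have ha' : (a : ℂ) = -(Complex.I / 2) * (L * y⁻¹ - M) := by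
    rw [ha]
    field_simp
    linear_combination (L - y * M) * hI
  have hchoose : ∀ j < n, ((2 * n).choose (n + (j + 1)) : ℂ) * (n + j + 1)
      = ((2 * n).choose (n + j) : ℂ) * ((n : ℂ) - j) := by
    intro j hj
    have h1 := Nat.choose_succ_right_eq (2 * n) (n + j)
    have h2 : 2 * n - (n + j) = n - j := by omega
    rw [h2] at h1
    have h3 := congrArg (fun m : ℕ => (m : ℂ)) h1
    push_cast [Nat.cast_sub hj.le] at h3
    rw [← add_assoc n j 1, add_assoc (n : ℂ)]
    linear_combination h3
  rcases k with _ | k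
  · rw [if_pos rfl, leviCivita, hfd, fderiv_linPow n 0]
    rcases n with _ | n
    · have h0 : component (polySection 0 (linPow 0 a 1) z) 1 = 0 := rfl
      rw [h0]
      simp [lineInner]
    · have hC := hchoose 0 (Nat.succ_pos n)
      simp only [zero_add, Nat.cast_zero, sub_zero, add_zero] at hC
      have hre : ∀ w : ℂ, (w.re : ℂ) = (w + conj w) / 2 := by
        intro w
        rw [Complex.add_conj]
        push_cast
        ring
      simp only [lineInner, Complex.ofReal_mul, Complex.ofReal_div, Complex.ofReal_pow, hre]
      have hcomp : component (polySection (n + 1) (linPow (n + 1) a 1) z) 1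
          = 2 * Complex.I * ((2 * (n + 1)).choose (n + 1 + 1) : ℂ) * L ^ (n + 1 + 1) * M ^ n := by
        rw [component_polySection, pow_one, ← hL, ← hydef, ← hM, Nat.add_sub_cancel]
      have hconj : conj (component (polySection (n + 1) (linPow (n + 1) a 1) z) 1)
          = -(2 * Complex.I) * ((2 * (n + 1)).choose (n + 1 + 1) : ℂ) * M ^ 2 * M ^ n * L ^ n
            * y ^ 2 := by
        rw [hcomp, map_mul, map_mul, map_mul, map_mul, map_pow, map_pow, map_natCast,
          Complex.conj_I, hMc, hLc, map_ofNat, mul_pow, div_pow]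
        field_simp
        ring
      rw [map_mul, Complex.conj_conj, hconj, hcomp, ← hL, ← hydef, ← hM, hMp, ha']
      have key := nabla_algebra_zero Complex.I ((2 * (n + 1)).choose (n + 1))
        ((2 * (n + 1)).choose (n + 1 + 1)) ((n + 1 : ℕ) : ℂ) X (conj X) (L ^ n) (M ^ n) M L y⁻¹
        hC
      simp only [add_zero, Nat.sub_zero, Nat.add_sub_cancel, Nat.cast_zero, pow_zero, one_mul,
        mul_one, zero_mul]
      refine Eq.trans ?_ key
      push_cast
      field_simp
      ring
  · rw [if_neg (Nat.succ_ne_zero k), if_pos hk, leviCivita, hfd, fderiv_linPow n (k + 1)]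
    rw [component_polySection, component_polySection, component_polySection]
    simp only [contract]
    obtain ⟨m, rfl⟩ : ∃ m, n = k + 1 + m := ⟨n - (k + 1), by omega⟩
    rw [← hL, ← hydef, ← hM, hMp]
    have s1 : k + 1 + m - (k + 1) = m := by omega
    have s2 : k + 1 + m - (k + 1 - 1) = m + 1 := by omega
    have s3 : k + 1 + m - (k + 1 + 1) = m - 1 := by omega
    have s4 : k + 1 + m + (k + 1) - 1 = k + 1 + m + k := by omega
    have s5 : k + 1 - 1 = k := by omega
    have c1 := hchoose k (by omega)
    have c2 : ((2 * (k + 1 + m)).choose (k + 1 + m + (k + 1 + 1)) : ℂ)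
        * ((((k + 1 + m + (k + 1) : ℕ) : ℂ)) + 1)
        = ((2 * (k + 1 + m)).choose (k + 1 + m + (k + 1)) : ℂ) * m := by
      rcases m with _ | m
      · rw [Nat.choose_eq_zero_of_lt (by omega)]
        simp
      · have := hchoose (k + 1) (by omega)
        push_cast at this ⊢
        linear_combination this
    rw [s1, s2, s3, s4, s5]
    rcases m with _ | m
    · have key := nabla_algebra_top Complex.I ((2 * Complex.I) ^ k)
        ((2 * (k + 1 + 0)).choose (k + 1 + 0 + k)) ((2 * (k + 1 + 0)).choose (k + 1 + 0 + (k + 1)))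
        ((k + 1 + 0 + (k + 1) : ℕ) : ℂ) ((k + 1 : ℕ) : ℂ) X (L ^ (k + 1 + 0 + k)) M L y⁻¹ hI
        (by push_cast at c1 ⊢; linear_combination c1) (by push_cast; ring)
      have c3 : ((2 * (k + 1 + 0)).choose (k + 1 + 0 + (k + 1 + 1)) : ℂ) = 0 := by
        rw [Nat.choose_eq_zero_of_lt (by omega), Nat.cast_zero]
      rw [c3, ha']
      refine Eq.trans ?_ key
      push_cast
      ring
    · have key := nabla_algebra Complex.I ((2 * Complex.I) ^ k)
        ((2 * (k + 1 + (m + 1))).choose (k + 1 + (m + 1) + k))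
        ((2 * (k + 1 + (m + 1))).choose (k + 1 + (m + 1) + (k + 1)))
        ((2 * (k + 1 + (m + 1))).choose (k + 1 + (m + 1) + (k + 1 + 1))) ((m + 1 : ℕ) : ℂ)
        ((k + 1 + (m + 1) + (k + 1) : ℕ) : ℂ)
        ((k + 1 : ℕ) : ℂ) X (conj X) (L ^ (k + 1 + (m + 1) + k)) M (M ^ m) L y⁻¹ hI
        (by push_cast at c1 ⊢; linear_combination c1) c2 (by push_cast; ring)
      rw [ha', Nat.add_sub_cancel]
      refine Eq.trans ?_ key
      push_cast
      ring

theorem nabla_add {n : ℕ} {Y Z : ℍ → Fibre n} (hY : IsSmooth Y) (hZ : IsSmooth Z) (z : ℍ) (X : ℂ) :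
    nabla (Y + Z) z X = nabla Y z X + nabla Z z X := by
  apply ext_component
  intro k hk
  have hYZ : IsSmooth (Y + Z) := ContDiffOn.add hY hZ
  have hlc : leviCivita k (fun w => component ((Y + Z) w) k) z X
      = leviCivita k (fun w => component (Y w) k) z X
        + leviCivita k (fun w => component (Z w) k) z X := by
    simp only [leviCivita, Pi.add_apply, component_add]
    rw [fderiv_fun_add (isSmooth_component hY z k) (isSmooth_component hZ z k)]
    simp only [add_apply]
    ring
  rw [component_add, nabla_component hY, nabla_component hZ, nabla_component hYZ]
  rcases k with _ | k
  · rw [if_pos rfl, if_pos rfl, if_pos rfl, hlc]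
    simp only [Pi.add_apply, component_add, lineInner, map_add, mul_add,
      Complex.add_re]
    push_cast
    ring
  · simp only [Nat.succ_ne_zero, if_false, if_pos hk]
    rw [hlc]
    simp only [Pi.add_apply, component_add, contract]
    ring

theorem nabla_smul {n : ℕ} (r : ℝ) {Y : ℍ → Fibre n} (hY : IsSmooth Y) (z : ℍ) (X : ℂ) :
    nabla (r • Y) z X = r • nabla Y z X := by
  apply ext_component
  intro k hk
  have hrY : IsSmooth (r • Y) := ContDiffOn.const_smul r hY
  have hlc : leviCivita k (fun w => component ((r • Y) w) k) z X
      = r * leviCivita k (fun w => component (Y w) k) z X := by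
    simp only [leviCivita, Pi.smul_apply, component_smul]
    rw [fderiv_fun_const_smul (isSmooth_component hY z k)]
    simp only [smul_apply, Complex.real_smul]
    ring
  rw [component_smul, nabla_component hY, nabla_component hrY]
  rcases k with _ | k
  · rw [if_pos rfl, if_pos rfl, hlc]
    simp only [Pi.smul_apply, component_smul, lineInner, Complex.real_smul, map_mul,
      Complex.conj_ofReal]
    rw [mul_left_comm X, Complex.re_ofReal_mul]
    push_cast
    ring
  · simp only [Nat.succ_ne_zero, if_false, if_pos hk]
    rw [hlc]
    simp only [Pi.smul_apply, component_smul, contract,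
      Complex.real_smul]
    ring

theorem isSmooth_polySection (n : ℕ) (v : StdSpace n) : IsSmooth (polySection n v) := by
  revert v
  apply polySection_span
  · rw [map_zero]
    exact contDiffOn_const
  · intro v w hv hw
    rw [map_add]
    exact ContDiffOn.add hv hw
  · intro r v hv
    rw [map_smul]
    exact ContDiffOn.const_smul r hv
  · intro a
    have hsm : ∀ m, ContDiffOn ℝ ∞ (fun w : ℂ => (expand (UpperHalfPlane.ofComplex w)
        (linPow n a 1).1).coeff m) {w : ℂ | 0 < w.im} := by
      intro m
      have h1 : ContDiff ℝ ∞ (fun w : ℂ => ((2 * n).choose m : ℂ) * (a * w + (1 : ℝ)) ^ m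
          * (Complex.conjCLE (a * w + (1 : ℝ) : ℂ)) ^ (2 * n - m)) := by
        have h2 : ContDiff ℝ ∞ (fun w : ℂ => (a * w + (1 : ℝ) : ℂ)) :=
          (contDiff_const.mul contDiff_id).add contDiff_const
        exact (contDiff_const.mul (h2.pow m)).mul ((Complex.conjCLE.contDiff.comp h2).pow _)
      refine h1.contDiffOn.congr fun w hw => ?_
      rw [UpperHalfPlane.ofComplex_apply_of_im_pos hw, expand_linPow]
      rfl
    have hy : ContDiffOn ℝ ∞ (fun w : ℂ => (UpperHalfPlane.ofComplex w).im)
        {w : ℂ | 0 < w.im} := by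
      refine Complex.imCLM.contDiff.contDiffOn.congr fun w hw => ?_
      rw [UpperHalfPlane.ofComplex_apply_of_im_pos hw]
      rfl
    have hyc : ContDiffOn ℝ ∞ (fun w : ℂ => ((UpperHalfPlane.ofComplex w).im : ℂ))
        {w : ℂ | 0 < w.im} := Complex.ofRealCLM.contDiff.comp_contDiffOn hy
    refine ContDiffOn.prodMk ?_ (contDiffOn_pi.2 fun i => ?_)
    · exact (Complex.reCLM.contDiff.comp_contDiffOn (hsm n)).div (hy.pow n)
        fun w _ => pow_ne_zero _ (UpperHalfPlane.im_ne_zero _)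
    · refine ContDiffOn.mul ?_ (hsm _)
      simp only [div_eq_mul_inv]
      exact (contDiffOn_const.mul (hyc.pow _)).mul ((hyc.pow n).inv
        fun w _ => pow_ne_zero _ (by exact_mod_cast UpperHalfPlane.im_ne_zero _))

/-- The flat bundle `(E, ∇)` is identified with the standard representation. -/
theorem nonempty_flatTrivialization (n : ℕ) : Nonempty (FlatTrivialization n) := by
  refine ⟨⟨polySection n, polySection_injective n, fun v => ⟨isSmooth_polySection n v, ?_⟩,
    polySection_equivariant n⟩⟩
  intro z X
  revert v
  apply polySection_span
  · have h0 := nabla_smul (n := n) 0 (isSmooth_polySection n 0) z X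
    rw [zero_smul, zero_smul] at h0
    rw [map_zero]
    exact h0
  · intro v w hv hw
    rw [map_add, nabla_add (isSmooth_polySection n v) (isSmooth_polySection n w), hv, hw, add_zero]
  · intro r v hv
    rw [map_smul, nabla_smul r (isSmooth_polySection n v), hv, smul_zero]
  · intro a
    exact nabla_linPow n a (isSmooth_polySection n _) z X

end

end FuchsianAffine

open FuchsianAffine

namespace FuchsianAffine

noncomputable section

/-! ### The metric on the line bundles and on `E` -/

/-! The integrand is, up to sign, the differential of a function on `ℍ`, and the integral measures
how far that function is from being `γ`-invariant.

Under the holonomy identification, a point `x` of the affine space corresponds to a `∇^α`-parallel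
section `(1, U)` of `ℝ ⊕ E`, so that `∇ U = -α`. Let `v` be fixed by the linear part of `ρ γ` and
put `f = ⌊U, T v⌋`. Since `∇` preserves `⌊ , ⌋` and `T v` is parallel, `df(X) = -⌊α(X), T v⌋`, and
the integral along `ctilde` is `f (ctilde 0) - f (ctilde 1)` by `IsPiecewiseC1.integral_fderiv`.

Equivariance gives `γ U = U + T (ρ(γ) x - x)`, because `(1, ρ(γ) x)` and `(1, x)` differ by a vector
of the linear part. Pairing with `T v`, which is `γ`-invariant, and using that `SL(2, ℝ)` acts by
isometries (`fibreForm_push`) yields `f z = f (γ z) + ⌊ρ(γ) x - x, v⌋`. At `z = ctilde 0` this is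
the claim.

The remaining work is the compatibility of `∇` with the metric (`fderiv_fibreForm`). The diagonal
part of `∇` is the Levi-Civita connection, which is metric on each `L_k`. The terms raising and
lowering the degree are adjoint up to constants, and the signs `(-1)^(k+1)` with the recursion of
the `a_k` make their sum skew. -/

theorem lineInner_comm (k : ℕ) (z : ℍ) (u v : ℂ) : lineInner k z u v = lineInner k z v u := by
  simp only [lineInner, Complex.mul_re, Complex.conj_re, Complex.conj_im]
  ring

theorem lineInner_add_left (k : ℕ) (z : ℍ) (u v w : ℂ) :
    lineInner k z (u + v) w = lineInner k z u w + lineInner k z v w := by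
  simp only [lineInner, add_mul, Complex.add_re, add_div]

theorem lineInner_ofReal_mul_left (k : ℕ) (z : ℍ) (r : ℝ) (u v : ℂ) :
    lineInner k z (r * u) v = r * lineInner k z u v := by
  simp only [lineInner, mul_assoc, Complex.re_ofReal_mul, mul_div_assoc]

theorem fibreForm_comm {n : ℕ} (z : ℍ) (Y Z : Fibre n) : fibreForm z Y Z = fibreForm z Z Y := by
  simp only [fibreForm, lineInner_comm _ z (component Y _)]

theorem fibreForm_add_left {n : ℕ} (z : ℍ) (Y Y' Z : Fibre n) :
    fibreForm z (Y + Y') Z = fibreForm z Y Z + fibreForm z Y' Z := by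
  simp only [fibreForm, component_add, lineInner_add_left, mul_add, Finset.sum_add_distrib]

theorem fibreForm_smul_left {n : ℕ} (z : ℍ) (r : ℝ) (Y Z : Fibre n) :
    fibreForm z (r • Y) Z = r * fibreForm z Y Z := by
  simp only [fibreForm, component_smul, Complex.real_smul, lineInner_ofReal_mul_left,
    Finset.mul_sum]
  exact Finset.sum_congr rfl fun k _ => by ring

theorem fibreForm_neg_left {n : ℕ} (z : ℍ) (Y Z : Fibre n) :
    fibreForm z (-Y) Z = -fibreForm z Y Z := by
  rw [← neg_one_smul ℝ, fibreForm_smul_left, neg_one_mul]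

theorem fibreForm_zero_right {n : ℕ} (z : ℍ) (Y : Fibre n) : fibreForm z Y 0 = 0 := by
  rw [fibreForm_comm, ← zero_smul ℝ (0 : Fibre n), fibreForm_smul_left, zero_mul]

theorem im_smul_eq_mul_norm_moebiusDeriv (g : SL(2, ℝ)) (z : ℍ) :
    (g • z).im = z.im * ‖moebiusDeriv g z‖ := by
  have h := UpperHalfPlane.im_smul_eq_div_normSq (g : GL (Fin 2) ℝ) z
  have h1 : (g • z).im = z.im / Complex.normSq (UpperHalfPlane.denom g z) := by
    rw [show g • z = (g : GL (Fin 2) ℝ) • z from rfl]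
    simpa using h
  rw [h1, moebiusDeriv, norm_div, norm_one, norm_pow, Complex.normSq_eq_norm_sq, mul_one_div]

theorem moebiusDeriv_ne_zero (g : SL(2, ℝ)) (z : ℍ) : moebiusDeriv g z ≠ 0 :=
  one_div_ne_zero (pow_ne_zero 2 (UpperHalfPlane.denom_ne_zero _ z))

/-- The numerator acquires the factor `|g'(z)|^(2k)`, and so does the denominator `y^(2k)`, because
`Im (g z) = |g'(z)| Im z`: Möbius maps are hyperbolic isometries. -/
theorem lineInner_moebiusDeriv (k : ℕ) (g : SL(2, ℝ)) (z : ℍ) (u v : ℂ) :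
    lineInner k (g • z) (moebiusDeriv g z ^ k * u) (moebiusDeriv g z ^ k * v)
      = lineInner k z u v := by
  have h : moebiusDeriv g z ^ k * u * conj (moebiusDeriv g z ^ k * v)
      = ((‖moebiusDeriv g z‖ ^ (2 * k) : ℝ) : ℂ) * (u * conj v) := by
    have h2 := Complex.mul_conj' (moebiusDeriv g z)
    rw [map_mul, map_pow, pow_mul]
    push_cast
    rw [← h2, mul_pow]
    ring
  rw [lineInner, h, Complex.re_ofReal_mul, im_smul_eq_mul_norm_moebiusDeriv, mul_pow, lineInner,
    mul_comm (z.im ^ _), mul_div_mul_left]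
  exact pow_ne_zero _ (norm_ne_zero_iff.2 (moebiusDeriv_ne_zero g z))

/-- The metric of `E` is preserved by the action of `SL(2, ℝ)`. -/
theorem fibreForm_push {n : ℕ} (g : SL(2, ℝ)) (z : ℍ) (Y Z : Fibre n) :
    fibreForm (g • z) (push g z Y) (push g z Z) = fibreForm z Y Z := by
  simp only [fibreForm, component_push, lineInner_moebiusDeriv]

/-! ### The connections preserve the metrics -/

theorem isOpen_im_pos : IsOpen {w : ℂ | 0 < w.im} :=
  isOpen_lt continuous_const Complex.continuous_im

theorem IsSmooth.differentiableAt {F : Type*} [NormedAddCommGroup F] [NormedSpace ℝ F]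
    {f : ℍ → F} (h : IsSmooth f) (z : ℍ) :
    DifferentiableAt ℝ (fun w : ℂ => f (UpperHalfPlane.ofComplex w)) z :=
  (h.contDiffAt (isOpen_im_pos.mem_nhds z.coe_im_pos)).differentiableAt (by simp)

/-- The Levi-Civita connection on `L_k` preserves the metric. -/
theorem hasFDerivAt_lineInner (k : ℕ) {f g : ℍ → ℂ} (z : ℍ)
    (hf : DifferentiableAt ℝ (fun w : ℂ => f (UpperHalfPlane.ofComplex w)) z)
    (hg : DifferentiableAt ℝ (fun w : ℂ => g (UpperHalfPlane.ofComplex w)) z) :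
    ∃ D : ℂ →L[ℝ] ℝ, HasFDerivAt (fun w : ℂ => lineInner k (UpperHalfPlane.ofComplex w)
      (f (UpperHalfPlane.ofComplex w)) (g (UpperHalfPlane.ofComplex w))) D z ∧
      ∀ X, D X = lineInner k z (leviCivita k f z X) (g z)
        + lineInner k z (f z) (leviCivita k g z X) := by
  have hz : z.im ≠ 0 := z.im_ne_zero
  have hgc := Complex.conjCLE.toContinuousLinearMap.hasFDerivAt.comp (z : ℂ) hg.hasFDerivAt
  have h1 := Complex.reCLM.hasFDerivAt.comp (z : ℂ) (hf.hasFDerivAt.mul hgc)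
  have h2 : HasFDerivAt (fun w : ℂ => w.im ^ (2 * k)) _ (z : ℂ) :=
    Complex.imCLM.hasFDerivAt.pow (2 * k)
  have h3 := h1.mul ((hasDerivAt_inv (pow_ne_zero (2 * k) hz)).comp_hasFDerivAt (z : ℂ) h2)
  refine ⟨_, h3.congr_of_eventuallyEq ?_, fun X => ?_⟩
  -- `ofComplex` has arbitrary values off the half-plane, so the explicit formula with `w.im` is
  -- only available near `z`.
  · filter_upwards [isOpen_im_pos.mem_nhds z.coe_im_pos] with w hw
    have him : (UpperHalfPlane.ofComplex w).im = w.im := by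
      rw [UpperHalfPlane.ofComplex_apply_of_im_pos hw]
      rfl
    simp only [lineInner, him]
    rfl
  -- Differentiating `y^(-2k)` contributes the factor `-2k Im X / y`, which equals `2 Re (k (i / y)
  -- X)`, the joint contribution of the two Christoffel terms.
  · simp only [lineInner, leviCivita, Function.comp_apply, UpperHalfPlane.ofComplex_apply]
    generalize fderiv ℝ (fun w : ℂ => f (UpperHalfPlane.ofComplex w)) z = F
    generalize fderiv ℝ (fun w : ℂ => g (UpperHalfPlane.ofComplex w)) z = G
    have hI : Complex.I / (z.im : ℂ) = ((z.im⁻¹ : ℝ) : ℂ) * Complex.I := by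
      push_cast
      ring
    rw [hI]
    simp
    -- The derivative of the power `2k` involves the truncated exponent `2k - 1`, hence a separate
    -- case for `k = 0`.
    rcases k with _ | k
    · simp
      ring
    · have h5 : 2 * (k + 1) - 1 = 2 * k + 1 := by omega
      rw [h5]
      push_cast
      field_simp
      ring

/-- The coefficient of the contraction term in the `L_k`-component of `∇`. -/
def contractCoeff (n k : ℕ) : ℝ := if k = 0 then (n + 1) / 2 else (n + k + 1) / 4

/-- The ratio `a_{k+1} / a_k` is the lowering coefficient at level `k` divided by the raising
coefficient `n - k` at level `k + 1`. The step `k = 0` is exceptional on both sides: `a_0 = 1` is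
half of what the general formula would extrapolate to, and the lowering coefficient has denominator
`2` instead of `4`. -/
theorem formCoeff_succ_mul {n k : ℕ} (hk : k < n) :
    formCoeff n (k + 1) * (n - k) = formCoeff n k * contractCoeff n k := by
  have hnk : (n : ℝ) - k ≠ 0 := sub_ne_zero.2 (by exact_mod_cast hk.ne')
  rcases k with _ | k
  · simp only [formCoeff, contractCoeff]
    simp at hnk ⊢
    field_simp
  · simp only [formCoeff, contractCoeff, if_neg (Nat.succ_ne_zero k)]
    rw [Finset.prod_range_succ _ (k + 1), show 2 * (k + 1) + 1 = 2 * k + 1 + 2 by ring, pow_add]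
    field_simp
    ring

/-- Contraction is moved to the other argument as multiplication by `X`. Both off-diagonal terms
then pair a vector of `L_{j+1}` with `X` times a vector of `L_j`, so they can be matched across
consecutive levels. -/
theorem lineInner_nabla {n : ℕ} {Y : ℍ → Fibre n} (hY : IsSmooth Y) (z : ℍ) (X : ℂ) {k : ℕ}
    (hk : k ≤ n) (V : Fibre n) :
    lineInner k z (component (nabla Y z X) k) (component V k) =
      lineInner k z (leviCivita k (fun w => component (Y w) k) z X) (component V k)
      + (if k = 0 then 0 else
        (n - k + 1) * lineInner k z (X * component (Y z) (k - 1)) (component V k))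
      + contractCoeff n k *
        lineInner (k + 1) z (component (Y z) (k + 1)) (X * component V k) := by
  rw [nabla_component hY]
  rcases k with _ | k
  -- On the real summand `V_0` is a real scalar, so `⟨X, Y_1⟩ V_0` is again `⟨Y_1, X V_0⟩`.
  · have h : component V 0 = ((V.1 : ℝ) : ℂ) := rfl
    have hr : ∀ r : ℝ, lineInner 0 z r (V.1 : ℂ) = r * V.1 := fun r => by simp [lineInner]
    rw [if_pos rfl, if_pos rfl, lineInner_add_left, contractCoeff, if_pos rfl, h, hr]
    simp [lineInner]
    ring
  · rw [if_neg (Nat.succ_ne_zero k), if_pos hk, if_neg (Nat.succ_ne_zero k), lineInner_add_left,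
      lineInner_add_left, contractCoeff, if_neg (Nat.succ_ne_zero k)]
    have h1 : ((n : ℂ) - (k + 1 : ℕ) + 1) = (((n : ℝ) - (k + 1 : ℕ) + 1 : ℝ) : ℂ) := by push_cast; rfl
    have h2 : ((n : ℂ) + (k + 1 : ℕ) + 1) / 4 = (((n + (k + 1 : ℕ) + 1) / 4 : ℝ) : ℂ) := by
      push_cast; rfl
    rw [h1, h2, lineInner_ofReal_mul_left, lineInner_ofReal_mul_left, lineInner_contract]
    ring

/-- The off-diagonal terms of `∇` are skew for the metric of `E`. -/
theorem sum_offDiagonal_eq_zero {n : ℕ} (R : ℕ → ℝ) (hR : R n = 0) :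
    ∑ k ∈ Finset.range (n + 1), (-1) ^ (k + 1) * formCoeff n k *
      ((if k = 0 then 0 else (n - k + 1) * R (k - 1)) + contractCoeff n k * R k) = 0 := by
  simp only [mul_add, Finset.sum_add_distrib]
  -- The raising sum is shifted by one, its `k = 0` term being zero, and the lowering sum loses its
  -- top term since `R n = 0`. The terms in `R k` then have opposite signs and equal size by
  -- `formCoeff_succ_mul`.
  rw [Finset.sum_range_succ', Finset.sum_range_succ, hR, if_pos rfl, mul_zero, mul_zero, mul_zero,
    add_zero, add_zero, ← Finset.sum_add_distrib]
  refine Finset.sum_eq_zero fun k hk => ?_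
  have h := formCoeff_succ_mul (Finset.mem_range.1 hk)
  rw [if_neg (Nat.succ_ne_zero k), Nat.add_sub_cancel]
  push_cast
  linear_combination (-1) ^ (k + 2) * R k * h

/-- Termwise differentiation produces only the Levi-Civita terms. The off-diagonal terms of `∇ Y`
and `∇ Z` may be added because together they sum to zero. -/
theorem hasFDerivAt_fibreForm {n : ℕ} {Y Z : ℍ → Fibre n} (hY : IsSmooth Y) (hZ : IsSmooth Z)
    (z : ℍ) :
    ∃ D : ℂ →L[ℝ] ℝ, HasFDerivAt (fun w : ℂ => fibreForm (UpperHalfPlane.ofComplex w)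
      (Y (UpperHalfPlane.ofComplex w)) (Z (UpperHalfPlane.ofComplex w))) D z ∧
      ∀ X, D X = fibreForm z (nabla Y z X) (Z z) + fibreForm z (Y z) (nabla Z z X) := by
  choose D hD hDX using fun k => hasFDerivAt_lineInner k (f := fun w => component (Y w) k)
    (g := fun w => component (Z w) k) z (isSmooth_component hY z k) (isSmooth_component hZ z k)
  refine ⟨_, HasFDerivAt.fun_sum fun k _ => (hD k).const_mul ((-1) ^ (k + 1) * formCoeff n k),
    fun X => ?_⟩
  have hcomp : ∀ V : Fibre n, component V (n + 1) = 0 := fun V => by simp [component]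
  -- `R k` collects the pairings between levels `k` and `k + 1` coming from both sections; `R n = 0`
  -- because `Y_{n+1} = Z_{n+1} = 0`.
  have hoff := sum_offDiagonal_eq_zero (n := n) (fun k =>
    lineInner (k + 1) z (component (Y z) (k + 1)) (X * component (Z z) k)
      + lineInner (k + 1) z (component (Z z) (k + 1)) (X * component (Y z) k))
    (by simp [hcomp, lineInner])
  rw [fibreForm_comm z (Y z)]
  refine (add_zero _).symm.trans ((congrArg (_ + ·) hoff.symm).trans ?_)
  simp only [fibreForm, sum_apply]
  rw [← Finset.sum_add_distrib, ← Finset.sum_add_distrib]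
  refine Finset.sum_congr rfl fun k hk => ?_
  have hk' : k ≤ n := Nat.lt_succ_iff.1 (Finset.mem_range.1 hk)
  rw [lineInner_nabla hY z X hk', lineInner_nabla hZ z X hk']
  simp only [smul_apply, hDX, smul_eq_mul]
  rw [lineInner_comm k z (component (Y z) k) (leviCivita _ _ _ _)]
  rcases k with _ | k
  · simp only [if_true]
    ring
  · simp only [Nat.succ_ne_zero, if_false, Nat.add_sub_cancel]
    rw [lineInner_comm (k + 1) z (X * component (Y z) k),
      lineInner_comm (k + 1) z (X * component (Z z) k)]
    ring

/-- The connection `∇` preserves the metric of `E`. -/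
theorem fderiv_fibreForm {n : ℕ} {Y Z : ℍ → Fibre n} (hY : IsSmooth Y) (hZ : IsSmooth Z)
    (z : ℍ) (X : ℂ) :
    fderiv ℝ (fun w : ℂ => fibreForm (UpperHalfPlane.ofComplex w)
      (Y (UpperHalfPlane.ofComplex w)) (Z (UpperHalfPlane.ofComplex w))) z X
      = fibreForm z (nabla Y z X) (Z z) + fibreForm z (Y z) (nabla Z z X) := by
  obtain ⟨D, hD, hDX⟩ := hasFDerivAt_fibreForm hY hZ z
  rw [hD.fderiv, hDX]

theorem contDiffOn_ofComplex_im :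
    ContDiffOn ℝ ∞ (fun w : ℂ => (UpperHalfPlane.ofComplex w).im) {w : ℂ | 0 < w.im} :=
  Complex.imCLM.contDiff.contDiffOn.congr fun w hw => by
    rw [UpperHalfPlane.ofComplex_apply_of_im_pos hw]
    rfl

theorem isSmooth_fibreForm {n : ℕ} {Y Z : ℍ → Fibre n} (hY : IsSmooth Y) (hZ : IsSmooth Z) :
    IsSmooth fun z => fibreForm z (Y z) (Z z) := by
  have hcomp : ∀ {Y : ℍ → Fibre n} (_ : IsSmooth Y) (k : ℕ),
      ContDiffOn ℝ ∞ (fun w : ℂ => component (Y (UpperHalfPlane.ofComplex w)) k)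
        {w : ℂ | 0 < w.im} := fun h k =>
    (LinearMap.toContinuousLinearMap (componentLin n k)).contDiff.comp_contDiffOn h
  refine ContDiffOn.sum fun k _ => contDiffOn_const.mul (ContDiffOn.div ?_
    (contDiffOn_ofComplex_im.pow _) fun w _ => pow_ne_zero _ (UpperHalfPlane.im_ne_zero _))
  exact Complex.reCLM.contDiff.comp_contDiffOn ((hcomp hY k).mul
    (Complex.conjCLE.contDiff.comp_contDiffOn (hcomp hZ k)))

/-- The value of `⌊ , ⌋` on two parallel sections is constant. -/
theorem fibreForm_toSection {n : ℕ} (T : FlatTrivialization n) (v w : StdSpace n) (z : ℍ) :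
    fibreForm z (T.toSection v z) (T.toSection w z) = T.form v w := by
  have hv := T.parallel v
  have hw := T.parallel w
  have hs := isSmooth_fibreForm hv.1 hw.1
  -- The half-plane is convex, hence connected, and the differential vanishes because both sections
  -- are parallel.
  have h := isOpen_im_pos.is_const_of_fderiv_eq_zero (𝕜 := ℝ)
    (convex_halfSpace_im_gt 0).isPreconnected (hs.differentiableOn (by simp))
    (fun x hx => by
      ext1 X
      have := fderiv_fibreForm hv.1 hw.1 ⟨x, hx⟩ X
      rw [hv.2, hw.2, fibreForm_zero_right, fibreForm_comm, fibreForm_zero_right, add_zero] at this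
      exact this) z.coe_im_pos UpperHalfPlane.I.coe_im_pos
  simp only [UpperHalfPlane.ofComplex_apply] at h
  exact h

/-! ### Integration along piecewise `C¹` curves -/

/-- The fundamental theorem of calculus along a piecewise `C¹` curve in `ℍ`. -/
theorem IsPiecewiseC1.integral_fderiv {ctilde : ℝ → ℍ} (hc : IsPiecewiseC1 ctilde) {f : ℍ → ℝ}
    (hf : IsSmooth f) {φ : ℝ → ℝ}
    (hφ : ∀ t, φ t = fderiv ℝ (fun w : ℂ => f (UpperHalfPlane.ofComplex w)) (ctilde t)
      (deriv (fun s => (ctilde s : ℂ)) t)) :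
    IntervalIntegrable φ MeasureTheory.volume 0 1 ∧
      ∫ t in (0 : ℝ)..1, φ t = f (ctilde 1) - f (ctilde 0) := by
  obtain ⟨N, p, hp, hp0, hpN, hC⟩ := hc
  have hpiece : ∀ i < N, IntervalIntegrable φ MeasureTheory.volume (p i) (p (i + 1)) ∧
      ∫ t in (p i)..(p (i + 1)), φ t = f (ctilde (p (i + 1))) - f (ctilde (p i)) := by
    intro i hi
    have hle := hp (Nat.le_succ i)
    -- Subdivision points may coincide; unique differentiability on the closed piece requires a
    -- nondegenerate interval.
    rcases hle.eq_or_lt with heq | hlt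
    · rw [← Nat.succ_eq_add_one, ← heq]
      simp
    have hcomp : ContDiffOn ℝ 1 (fun t => f (ctilde t)) (Set.Icc (p i) (p (i + 1))) := by
      have h := ContDiffOn.comp (ContDiffOn.of_le hf (by simp : (1 : WithTop ℕ∞) ≤ ∞)) (hC i hi)
        (fun t _ => (ctilde t).coe_im_pos)
      exact h.congr fun t _ => by simp
    -- Only interior points are compared: at a corner `deriv` takes a default value unrelated to the
    -- one-sided derivatives, which affects neither integrability nor the integral.
    have hder : ∀ t ∈ Set.Ioo (p i) (p (i + 1)), deriv (fun t => f (ctilde t)) t = φ t := by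
      intro t ht
      have h1 : DifferentiableAt ℝ (fun s => (ctilde s : ℂ)) t :=
        ((hC i hi).contDiffAt (Icc_mem_nhds ht.1 ht.2)).differentiableAt (by simp)
      have h2 := (IsSmooth.differentiableAt hf (ctilde t)).hasFDerivAt.comp_hasDerivAt t
        h1.hasDerivAt
      have h3 := h2.deriv
      rw [hφ, ← h3]
      congr 1
      funext s
      simp
    constructor
    -- The one-sided derivative on the closed piece is continuous, hence integrable, and agrees with
    -- `φ` in the interior.
    · have h4 := (hcomp.continuousOn_derivWithin (uniqueDiffOn_Icc hlt) le_rfl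
        ).intervalIntegrable_of_Icc (μ := MeasureTheory.volume) hle
      refine h4.congr_uIoo fun t ht => ?_
      rw [Set.uIoo_of_le hle] at ht
      rw [← hder t ht, derivWithin_of_mem_nhds (Icc_mem_nhds ht.1 ht.2)]
    · rw [← intervalIntegral.integral_deriv_of_contDiffOn_Icc hcomp hle]
      exact intervalIntegral.integral_congr_Ioo_of_le hle fun t ht => (hder t ht).symm
  have hint : ∀ i < N, IntervalIntegrable φ MeasureTheory.volume (p i) (p (i + 1)) :=
    fun i hi => (hpiece i hi).1
  constructor
  · have h := IntervalIntegrable.trans_iterate hint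
    rwa [hp0, hpN] at h
  · have h := intervalIntegral.sum_integral_adjacent_intervals hint
    rw [hp0, hpN] at h
    rw [← h, Finset.sum_congr rfl fun i hi => (hpiece i (Finset.mem_range.1 hi)).2,
      Finset.sum_range_sub (fun i => f (ctilde (p i))), hp0, hpN]

/-! ### The Margulis invariant as an integral -/

/-- Being fixed is all that the integral formula asks of `v`, and the default value `0` is fixed as
well, so both branches of the definition qualify. -/
theorem apply_invariantVector {n : ℕ} (T : FlatTrivialization n)
    (o : Orientation ℝ (StdSpace n) (Fin (2 * n + 1))) (θ : NullOrientation T)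
    (g : StdSpace n →ₗ[ℝ] StdSpace n) :
    g (invariantVector T o θ g) = invariantVector T o θ g := by
  rw [invariantVector]
  split_ifs with h
  · exact h.choose_spec.1
  · exact map_zero g

/-- This is `g x = ĝ x + g 0`; it turns equivariance of the linear identification into a statement
about the affine action at `x`. -/
theorem affineToLinear_one {V : Type*} [AddCommGroup V] [Module ℝ V] (g : V ≃ᵃ[ℝ] V) (x : V) :
    affineToLinear g (1, x) = (1, g x) := by
  have h := g.map_vadd 0 x
  simp only [vadd_eq_add, add_zero] at h
  simp [affineToLinear, h]

/-- For a vector `v` fixed by the linear part of `ρ(γ)`, the integral of `⌊α, v_c⌋` along a curve in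
the class of `γ` is `⌊ρ(γ)(x) - x, v⌋`. -/
theorem integral_integrand_of_fixed {n : ℕ} {Γ : Type*} [Group Γ] {ι : Γ →* SL(2, ℝ)}
    (T : FlatTrivialization n) {ρ : Γ →* (StdSpace n ≃ᵃ[ℝ] StdSpace n)} {α : ClosedForm ι n}
    (hα : HasHolonomy T α ρ) {γ : Γ} {ctilde : ℝ → ℍ} (hC1 : IsPiecewiseC1 ctilde)
    (hc : ctilde 1 = ι γ • ctilde 0) {v : StdSpace n} (hv : stdRep n (ι γ) v = v) (x : StdSpace n) :
    IntervalIntegrable (integrand T α ctilde v) MeasureTheory.volume 0 1 ∧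
      ∫ t in (0 : ℝ)..1, integrand T α ctilde v t = T.form (ρ γ x - x) v := by
  obtain ⟨D, hD, hDγ, hDT, hD1⟩ := hα
  have hpar := T.parallel v
  -- A primitive of `-α`: the `E`-part of the `∇^α`-parallel section through the affine point `x`,
  -- whose `ℝ`-part is constantly `1`.
  set U : ℍ → Fibre n := fun z => (D (1, x) z).2 with hU
  have hUs : IsSmooth U := contDiff_snd.comp_contDiffOn (hD (1, x)).1
  have hUα : ∀ z X, nabla U z X = -α.form z X := by
    intro z X
    have h := congrArg Prod.snd ((hD (1, x)).2 z X)
    simp only [nablaForm, hD1, one_smul, Prod.snd_zero] at h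
    exact (neg_eq_of_add_eq_zero_right h).symm
  have hUγ : ∀ z, push (ι γ) z (U z) = U (ι γ • z) + T.toSection (ρ γ x - x) (ι γ • z) := by
    intro z
    have h1 := congrArg Prod.snd (hDγ γ (1, x) z)
    have h2 : ((1, ρ γ x) : ℝ × StdSpace n) = (1, x) + (0, ρ γ x - x) := by simp
    rw [affineToLinear_one, h2, map_add, Pi.add_apply, Prod.snd_add, hDT] at h1
    exact h1.symm
  obtain ⟨h1, h2⟩ := hC1.integral_fderiv (isSmooth_fibreForm hUs hpar.1)
    (φ := -integrand T α ctilde v) (fun t => by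
      rw [fderiv_fibreForm hUs hpar.1, hpar.2, fibreForm_zero_right, add_zero, hUα,
        fibreForm_neg_left]
      rfl)
  refine ⟨by simpa using h1.neg, ?_⟩
  -- As `v` is fixed, the section `T v` is `γ`-invariant, so the isometry `push` can be applied to
  -- the pairing of `U` with `T v`.
  have h3 := T.equivariant (ι γ) v (ctilde 0)
  rw [hv] at h3
  have h4 := fibreForm_push (ι γ) (ctilde 0) (U (ctilde 0)) (T.toSection v (ctilde 0))
  rw [← h3, hUγ, fibreForm_add_left, fibreForm_toSection] at h4
  simp only [Pi.neg_apply, intervalIntegral.integral_neg] at h2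
  rw [hc] at h2
  linarith

end

end FuchsianAffine

theorem mainTheorem5 (n : ℕ) {Γ : Type*} [Group Γ] (ι : Γ →* SL(2, ℝ)) (hι : IsSurfaceGroup ι)
    (T : FlatTrivialization n) (o : Orientation ℝ (StdSpace n) (Fin (2 * n + 1)))
    (θ : NullOrientation T)
    (ρ : Γ →* (StdSpace n ≃ᵃ[ℝ] StdSpace n))
    (hρ : ∀ (γ : Γ) (v : StdSpace n), (ρ γ).linear v = stdRep n (ι γ) v)
    (α : ClosedForm ι n) (hα : HasHolonomy T α ρ)
    (γ : Γ) (hγ : γ ≠ 1)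
    (c : C(AddCircle (1 : ℝ), Surface ι)) (ctilde : ℝ → ℍ)
    (hlift : IsLift c ctilde) (hC1 : IsPiecewiseC1 ctilde) (hc : ctilde 1 = ι γ • ctilde 0) :
    IntervalIntegrable (integrand T α ctilde (invariantVector T o θ (ρ γ).linear))
      MeasureTheory.volume 0 1 ∧
    ∀ x : StdSpace n, margulisInvariant T o θ (ρ γ) x =
      ∫ t in (0 : ℝ)..1, integrand T α ctilde (invariantVector T o θ (ρ γ).linear) t := by
  have hv : stdRep n (ι γ) (invariantVector T o θ (ρ γ).linear)
      = invariantVector T o θ (ρ γ).linear := by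
    rw [← hρ]
    exact apply_invariantVector T o θ _
  -- The integrand does not involve `x`, so any base point, here `0`, gives integrability.
  exact ⟨(integral_integrand_of_fixed T hα hC1 hc hv 0).1,
    fun x => (integral_integrand_of_fixed T hα hC1 hc hv x).2.symm⟩
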